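/- Let $n\in\mathbb N$, let $A_{-1}$ be a real $n\times n$ matrix and let $A_2,A_3$ be $n\times n$-matrix functions on $[-1,0]$ with entries in $L_2(-1,0)$. Consider the neutral type equation $$\dot z(t)=A_{-1}\dot z(t-1)+\int_{-1}^0\bigl[A_2(\theta)\dot z(t+\theta)+A_3(\theta)z(t+\theta)\bigr]\,d\theta ,\qquad t>0. \tag{1}$$ Let $M_2=\mathbb R^n\times L_2(-1,0;\mathbb R^n)$, let $H^1=H^1([-1,0];\mathbb R^n)$, and let $\mathcal A$ be the operator in $M_2$ given by $$\mathcal A(v,\varphi)=\Bigl(\int_{-1}^0[A_2(\theta)\varphi'(\theta)+A_3(\theta)\varphi(\theta)]\,d\theta,\ \varphi'\Bigr),\qquad D(\mathcal A)=\{(v,\varphi):\varphi\in H^1,\ v=\varphi(0)-A_{-1}\varphi(-1)\}.$$ Let $X_1=D(\mathcal A)$ with the graph norm $\|x\|_1=(\|x\|^2+\|\mathcal A x\|^2)^{1/2}$. Let $\tilde{\mathcal A}$ be the operator in $M_2$ whose domain consists of the pairs $(w,\psi)$ such that $r:=\psi+A_2w\in H^1$ and $A_{-1}r(0)=r(-1)$,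 and which is given by $\tilde{\mathcal A}(w,\psi)=(r(0),\,-r'+A_3w)$. Say that $\xi_0\in D(\mathcal A)$ and $\tilde x_0\in M_2$ are related if, for a mild solution $x(t)=(w(t),\psi_t)$, $t\ge 0$, of $\dot x=\tilde{\mathcal A}x$, $x(0)=\tilde x_0$ (that is, $x$ is continuous and $\int_0^t x\in D(\tilde{\mathcal A})$, $x(t)=\tilde x_0+\tilde{\mathcal A}\int_0^t x$ for all $t\ge0$), the function $z(t)=w(t+1)$, $t\ge-1$, is locally absolutely continuous with locally square integrable derivative, satisfies (1) for almost all $t>0$ (equivalently, $w$ satisfies $$\dot w(t+1)=A_{-1}\dot w(t)+\int_{-1}^0[A_2(\tau)\dot w(t+1+\tau)+A_3(\tau)w(t+1+\tau)]\,d\tau$$ for almost all $t>0$), and has the initial state $\xi_0=\bigl(w(1)-A_{-1}w(0),\ w(1+\cdot)|_{[-1,0]}\bigr)$. Then this relation is the graph of an operator $F$: for every $\xi_0\in D(\mathcal A)$ there is exactly one $\tilde x_0=:F\xi_0\in M_2$ related to it. The operator $F$ is linear and bounded from $X_1$ to $M_2$, it is a bijection of $X_1$ onto $M_2$, and its inverse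 $F^{-1}:M_2\to X_1$ is bounded. -/

import Mathlib

open MeasureTheory Set

namespace Neutral

/-- `ℝⁿ` with its Euclidean norm. -/
abbrev E (n : ℕ) : Type := EuclideanSpace ℝ (Fin n)

/-- Lebesgue measure on the interval `(-1, 0]`. -/
noncomputable abbrev μ : Measure ℝ := volume.restrict (Ioc (-1) 0)

/-- The Hilbert space `M₂ = ℝⁿ × L₂(-1, 0; ℝⁿ)`. -/
abbrev M₂ (n : ℕ) : Type := WithLp 2 (E n × Lp (E n) 2 μ)

/-- `M v`, for a square matrix `M` and a vector `v` of `ℝⁿ`. -/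
noncomputable abbrev app {n : ℕ} (M : Matrix (Fin n) (Fin n) ℝ) (v : E n) : E n :=
  Matrix.toEuclideanLin M v

/-- `f` belongs to `H¹([a, b]; ℝⁿ)` with derivative `f'`: the function `f'` is in `L₂` and `f`
is its (absolutely continuous) primitive. -/
structure IsH1On {n : ℕ} (a b : ℝ) (f f' : ℝ → E n) : Prop where
  memLp : MemLp f' 2 (volume.restrict (Ioc a b))
  eq_primitive : ∀ θ ∈ Icc a b, f θ = f a + ∫ s in a..θ, f' s

section H1

variable {n : ℕ} {a b : ℝ} {f f' g g' : ℝ → E n}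

theorem IsH1On.intervalIntegrable (h : IsH1On a b f f') {θ : ℝ} (hθ : θ ∈ Icc a b) :
    IntervalIntegrable f' volume a θ := by
  rw [intervalIntegrable_iff_integrableOn_Ioc_of_le hθ.1]
  have h1 : IntegrableOn f' (Ioc a b) := h.memLp.integrable (by norm_num)
  exact h1.mono_set (Ioc_subset_Ioc_right hθ.2)

theorem IsH1On.zero : IsH1On a b (0 : ℝ → E n) 0 :=
  ⟨MemLp.zero, fun θ _ => by simp⟩

theorem IsH1On.add (hf : IsH1On a b f f') (hg : IsH1On a b g g') :
    IsH1On a b (f + g) (f' + g') := by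
  refine ⟨hf.memLp.add hg.memLp, fun θ hθ => ?_⟩
  simp only [Pi.add_apply]
  rw [intervalIntegral.integral_add (hf.intervalIntegrable hθ) (hg.intervalIntegrable hθ),
    hf.eq_primitive θ hθ, hg.eq_primitive θ hθ]
  abel

theorem IsH1On.smul (c : ℝ) (hf : IsH1On a b f f') : IsH1On a b (c • f) (c • f') := by
  refine ⟨hf.memLp.const_smul c, fun θ hθ => ?_⟩
  simp only [Pi.smul_apply]
  rw [intervalIntegral.integral_smul, hf.eq_primitive θ hθ, smul_add]

theorem IsH1On.continuousOn (hf : IsH1On a b f f') : ContinuousOn f (Icc a b) := by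
  have h1 : IntegrableOn f' (Icc a b) :=
    by
    have h : IntegrableOn f' (Ioc a b) := hf.memLp.integrable (by norm_num)
    rwa [← integrableOn_Icc_iff_integrableOn_Ioc] at h
  refine ContinuousOn.congr (f := fun θ => f a + ∫ s in a..θ, f' s) ?_ hf.eq_primitive
  refine continuousOn_const.add ?_
  rcases le_or_gt a b with hab | hab
  · have h2 := intervalIntegral.continuousOn_primitive_interval (μ := volume)
      (f := f') (a := a) (b := b) (by rwa [uIcc_of_le hab])
    rwa [uIcc_of_le hab] at h2
  · rw [Icc_eq_empty (not_le.mpr hab)]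
    exact continuousOn_empty _

theorem IsH1On.eqOn_zero (hab : a < b) (hf : IsH1On a b f f')
    (h0 : f =ᵐ[volume.restrict (Ioc a b)] 0) : ∀ θ ∈ Icc a b, f θ = 0 := by
  have h1 : f =ᵐ[volume.restrict (Icc a b)] 0 := by
    rwa [Measure.restrict_congr_set Ioc_ae_eq_Icc.symm]
  exact Measure.eqOn_Icc_of_ae_eq volume hab.ne h1 hf.continuousOn continuousOn_const

theorem IsH1On.deriv_ae_zero (hab : a < b) (hf : IsH1On a b f f')
    (h0 : f =ᵐ[volume.restrict (Ioc a b)] 0) : f' =ᵐ[volume.restrict (Ioc a b)] 0 := by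
  have hz := hf.eqOn_zero hab h0
  have hd := (hf.intervalIntegrable (right_mem_Icc.mpr hab.le)).ae_hasDerivAt_integral
  have hb : ∀ᵐ x : ℝ, x ≠ b := by simp [ae_iff, measure_singleton]
  rw [Filter.EventuallyEq, ae_restrict_iff' measurableSet_Ioc]
  filter_upwards [hd, hb] with x hx hxb hxI
  rw [uIcc_of_le hab.le] at hx
  have h1 := hx ⟨hxI.1.le, hxI.2⟩ a (left_mem_Icc.mpr hab.le)
  have h2 : HasDerivAt (fun y => ∫ t in a..y, f' t) 0 x := by
    refine (hasDerivAt_const x (0 : E n)).congr_of_eventuallyEq ?_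
    filter_upwards [Icc_mem_nhds hxI.1 (lt_of_le_of_ne hxI.2 hxb)] with y hy
    have h3 := hf.eq_primitive y hy
    rw [hz y hy, hz a (left_mem_Icc.mpr hab.le), zero_add] at h3
    exact h3.symm
  exact h1.unique h2

end H1

/-- The coefficients of the neutral type equation
`ż(t) = A₁ ż(t-1) + ∫_{-1}^0 [A₂(θ) ż(t+θ) + A₃(θ) z(t+θ)] dθ`,
where `A₁` stands for the matrix usually written `A_{-1}`. -/
structure System (n : ℕ) where
  A₁ : Matrix (Fin n) (Fin n) ℝ
  A₂ : ℝ → Matrix (Fin n) (Fin n) ℝ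
  A₃ : ℝ → Matrix (Fin n) (Fin n) ℝ
  memLp₂ : ∀ i j, MemLp (fun θ => A₂ θ i j) 2 μ
  memLp₃ : ∀ i j, MemLp (fun θ => A₃ θ i j) 2 μ

theorem intervalIntegrable_app {n : ℕ} {M : ℝ → Matrix (Fin n) (Fin n) ℝ} {f : ℝ → E n}
    (hM : ∀ i j, MemLp (fun θ => M θ i j) 2 μ) (hf : MemLp f 2 μ) :
    IntervalIntegrable (fun θ => app (M θ) (f θ)) volume (-1) 0 := by
  rw [intervalIntegrable_iff_integrableOn_Ioc_of_le (by norm_num)]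
  refine Integrable.of_eval_piLp fun i => ?_
  have h : ∀ θ, (app (M θ) (f θ)) i = ∑ j, M θ i j * f θ j := fun θ => rfl
  simp only [h]
  exact integrable_finsetSum _ fun j _ => (hM i j).integrable_mul (hf.eval_piLp j)

theorem IsH1On.memLp_self {n : ℕ} {f f' : ℝ → E n} (hf : IsH1On (-1) 0 f f') : MemLp f 2 μ := by
  obtain ⟨C, hC⟩ := isCompact_Icc.exists_bound_of_continuousOn hf.continuousOn
  refine MemLp.of_bound ?_ C ?_
  · exact (hf.continuousOn.mono Ioc_subset_Icc_self).aestronglyMeasurable measurableSet_Ioc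
  · rw [ae_restrict_iff' measurableSet_Ioc]
    exact Filter.Eventually.of_forall fun θ hθ => hC θ (Ioc_subset_Icc_self hθ)

namespace System

variable {n : ℕ} (S : System n)

/-- `L f = ∫_{-1}^0 [A₂(θ) f'(θ) + A₃(θ) f(θ)] dθ`. -/
noncomputable def L (f f' : ℝ → E n) : E n :=
  ∫ θ in (-1 : ℝ)..0, (app (S.A₂ θ) (f' θ) + app (S.A₃ θ) (f θ))

theorem integrable_L {f f' : ℝ → E n} (hf : IsH1On (-1) 0 f f') :
    IntervalIntegrable (fun θ => app (S.A₂ θ) (f' θ) + app (S.A₃ θ) (f θ)) volume (-1) 0 :=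
  (intervalIntegrable_app S.memLp₂ hf.memLp).add
    (intervalIntegrable_app S.memLp₃ hf.memLp_self)

/-- `z`, with derivative `z'`, lies in `H¹([-1, 0]; ℝⁿ)`, and `(v, φ) ∈ M₂` is the state it
determines: `φ = z` on `(-1, 0)` and `v = z(0) - A₁ z(-1)`. -/
def IsState (ξ : M₂ n) (z z' : ℝ → E n) : Prop :=
  IsH1On (-1) 0 z z' ∧ ξ.snd =ᵐ[μ] z ∧ ξ.fst = z 0 - app S.A₁ (z (-1))

/-- The graph of the operator `𝒜 (v, φ) = (L φ, φ')`,
`D(𝒜) = {(v, φ) : φ ∈ H¹, v = φ(0) - A₁ φ(-1)}`. -/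
noncomputable def graphA : Submodule ℝ (M₂ n × M₂ n) where
  carrier := {p | ∃ z z' : ℝ → E n, S.IsState p.1 z z' ∧
    p.2.fst = S.L z z' ∧ p.2.snd =ᵐ[μ] z'}
  zero_mem' := by
    refine ⟨0, 0, ⟨IsH1On.zero, Lp.coeFn_zero _ _ _, by simp⟩, by simp [L], Lp.coeFn_zero _ _ _⟩
  add_mem' := by
    rintro p q ⟨z, z', ⟨hz, hφ, hv⟩, hL, hd⟩ ⟨y, y', ⟨hy, hφ', hv'⟩, hL', hd'⟩
    refine ⟨z + y, z' + y', ⟨hz.add hy, ?_, ?_⟩, ?_, ?_⟩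
    · exact (Lp.coeFn_add _ _).trans (hφ.add hφ')
    · simp only [Prod.fst_add, WithLp.add_fst, hv, hv', Pi.add_apply, map_add]
      abel
    · simp only [Prod.snd_add, WithLp.add_fst, hL, hL', L]
      rw [← intervalIntegral.integral_add (S.integrable_L hz) (S.integrable_L hy)]
      refine intervalIntegral.integral_congr fun θ _ => ?_
      simp only [Pi.add_apply, map_add]
      abel
    · exact (Lp.coeFn_add _ _).trans (hd.add hd')
  smul_mem' := by
    rintro c p ⟨z, z', ⟨hz, hφ, hv⟩, hL, hd⟩
    refine ⟨c • z, c • z', ⟨hz.smul c, ?_, ?_⟩, ?_, ?_⟩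
    · exact (Lp.coeFn_smul _ _).trans (hφ.const_smul c)
    · simp only [Prod.smul_fst, WithLp.smul_fst, hv, Pi.smul_apply, map_smul, smul_sub]
    · simp only [Prod.smul_snd, WithLp.smul_fst, hL, L, Pi.smul_apply, map_smul, ← smul_add]
      rw [intervalIntegral.integral_smul]
    · exact (Lp.coeFn_smul _ _).trans (hd.const_smul c)

/-- The state operator `𝒜` of the neutral type equation. -/
noncomputable def opA : M₂ n →ₗ.[ℝ] M₂ n := S.graphA.toLinearPMap

/-- The graph of the operator
`𝒜~ (w, ψ) = (A₂(0) w + ψ(0), -(ψ + A₂ w)' + A₃ w)` with domain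
`D(𝒜~) = {(w, ψ) : ψ + A₂ w ∈ H¹, (A₁ A₂(0) - A₂(-1)) w = ψ(-1) - A₁ ψ(0)}`.
In terms of `r = ψ + A₂ w ∈ H¹`, whose boundary values are the only ones that make sense, it is
`𝒜~ (w, ψ) = (r(0), -r' + A₃ w)` and the boundary condition is `A₁ r(0) = r(-1)`. -/
noncomputable def graphAt : Submodule ℝ (M₂ n × M₂ n) where
  carrier := {p | ∃ r r' : ℝ → E n, IsH1On (-1) 0 r r' ∧
    (∀ᵐ θ ∂μ, p.1.snd θ + app (S.A₂ θ) p.1.fst = r θ) ∧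
    app S.A₁ (r 0) = r (-1) ∧
    p.2.fst = r 0 ∧
    (∀ᵐ θ ∂μ, p.2.snd θ = -r' θ + app (S.A₃ θ) p.1.fst)}
  zero_mem' := by
    refine ⟨0, 0, IsH1On.zero, ?_, by simp, by simp, ?_⟩
    · filter_upwards [Lp.coeFn_zero (E n) 2 μ] with θ hθ
      change (0 : Lp (E n) 2 μ) θ + app (S.A₂ θ) 0 = 0
      rw [hθ]
      simp
    · filter_upwards [Lp.coeFn_zero (E n) 2 μ] with θ hθ
      change (0 : Lp (E n) 2 μ) θ = -(0 : E n) + app (S.A₃ θ) 0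
      rw [hθ]
      simp
  add_mem' := by
    rintro p q ⟨r, r', hr, h1, h2, h3, h4⟩ ⟨s, s', hs, k1, k2, k3, k4⟩
    refine ⟨r + s, r' + s', hr.add hs, ?_, ?_, ?_, ?_⟩
    · filter_upwards [h1, k1, Lp.coeFn_add p.1.snd q.1.snd] with θ a b c
      simp only [Prod.fst_add, WithLp.add_fst, WithLp.add_snd, c, Pi.add_apply, map_add, ← a, ← b]
      abel
    · simp only [Pi.add_apply, map_add, h2, k2]
    · simp only [Prod.snd_add, WithLp.add_fst, Pi.add_apply, h3, k3]
    · filter_upwards [h4, k4, Lp.coeFn_add p.2.snd q.2.snd] with θ a b c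
      simp only [Prod.fst_add, Prod.snd_add, WithLp.add_fst, WithLp.add_snd, c, Pi.add_apply,
        map_add, a, b]
      abel
  smul_mem' := by
    rintro c p ⟨r, r', hr, h1, h2, h3, h4⟩
    refine ⟨c • r, c • r', hr.smul c, ?_, ?_, ?_, ?_⟩
    · filter_upwards [h1, Lp.coeFn_smul c p.1.snd] with θ a b
      simp only [Prod.smul_fst, WithLp.smul_fst, WithLp.smul_snd, b, Pi.smul_apply, map_smul,
        ← a, smul_add]
    · simp only [Pi.smul_apply, map_smul, h2]
    · simp only [Prod.smul_snd, WithLp.smul_fst, Pi.smul_apply, h3]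
    · filter_upwards [h4, Lp.coeFn_smul c p.2.snd] with θ a b
      simp only [Prod.smul_fst, Prod.smul_snd, WithLp.smul_fst, WithLp.smul_snd, b, Pi.smul_apply,
        map_smul, a, smul_add, smul_neg]

/-- The state operator `𝒜~` of the transposed-form system. -/
noncomputable def opAt : M₂ n →ₗ.[ℝ] M₂ n := S.graphAt.toLinearPMap

theorem opA_graph : S.opA.graph = S.graphA := by
  refine Submodule.toLinearPMap_graph_eq _ ?_
  rintro ⟨x, y⟩ ⟨z, z', ⟨hz, hφ, -⟩, hL, hd⟩ (rfl : x = 0)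
  have h0 : z =ᵐ[μ] 0 := hφ.symm.trans (Lp.coeFn_zero _ _ _)
  have h1 := hz.eqOn_zero (by norm_num) h0
  have h2 := hz.deriv_ae_zero (by norm_num) h0
  have h3 : S.L z z' = 0 := by
    rw [L, intervalIntegral.integral_of_le (by norm_num)]
    refine integral_eq_zero_of_ae ?_
    filter_upwards [h0, h2] with θ a b
    simp [a, b]
  refine WithLp.ofLp_injective 2 (Prod.ext (hL.trans h3) ?_)
  exact Lp.ext ((hd.trans h2).trans (Lp.coeFn_zero _ _ _).symm)

theorem opAt_graph : S.opAt.graph = S.graphAt := by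
  refine Submodule.toLinearPMap_graph_eq _ ?_
  rintro ⟨x, y⟩ ⟨r, r', hr, h1, -, h3, h4⟩ (rfl : x = 0)
  have h0 : r =ᵐ[μ] 0 := by
    filter_upwards [h1, Lp.coeFn_zero (E n) 2 μ] with θ a b
    change (0 : Lp (E n) 2 μ) θ + app (S.A₂ θ) 0 = r θ at a
    rw [← a, b]
    simp
  have k1 := hr.eqOn_zero (by norm_num) h0
  have k2 := hr.deriv_ae_zero (by norm_num) h0
  refine WithLp.ofLp_injective 2 (Prod.ext (h3.trans (k1 0 (by norm_num))) ?_)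
  refine Lp.ext ?_
  filter_upwards [h4, k2, Lp.coeFn_zero (E n) 2 μ] with θ a b c
  change y.snd θ = (0 : Lp (E n) 2 μ) θ
  rw [a, b, c]
  simp

/-- `z : [-1, ∞) → ℝⁿ`, with derivative `z'`, solves the neutral type equation
`ż(t) = A₁ ż(t-1) + ∫_{-1}^0 [A₂(θ) ż(t+θ) + A₃(θ) z(t+θ)] dθ` for almost all `t > 0`. -/
structure IsSolution (z z' : ℝ → E n) : Prop where
  isH1On : ∀ T : ℝ, 0 ≤ T → IsH1On (-1) T z z'
  eqn : ∀ᵐ t ∂(volume.restrict (Ioi (0 : ℝ))),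
    z' t = app S.A₁ (z' (t - 1)) + S.L (fun θ => z (t + θ)) (fun θ => z' (t + θ))

end System

/-- The graph norm `(‖x‖² + ‖T x‖²)^(1/2)` on the domain of an operator `T`. -/
noncomputable def graphNorm {H : Type*} [NormedAddCommGroup H] [NormedSpace ℝ H]
    (T : H →ₗ.[ℝ] H) (x : T.domain) : ℝ :=
  √(‖(x : H)‖ ^ 2 + ‖T x‖ ^ 2)

/-- `x : [0, ∞) → H` is the mild solution of `ẋ = T x`, `x(0) = x₀`: it is continuous and
`∫_0^t x ∈ D(T)`, `x(t) = x₀ + T ∫_0^t x` for all `t ≥ 0`. -/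
structure IsMildSolution {H : Type*} [NormedAddCommGroup H] [NormedSpace ℝ H]
    (T : H →ₗ.[ℝ] H) (x₀ : H) (x : ℝ → H) : Prop where
  continuousOn : ContinuousOn x (Ici 0)
  init : x 0 = x₀
  eqn : ∀ t, 0 ≤ t → ∃ h : ∫ s in (0 : ℝ)..t, x s ∈ T.domain,
    x t = x₀ + T ⟨∫ s in (0 : ℝ)..t, x s, h⟩

/-- The relation between the initial data `ξ₀` of the neutral type equation and the initial data
`x₀` of the transposed-form system: if `(w(t), ψ_t)` is the mild solution of `ẋ = 𝒜~ x` starting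
at `x₀`, then `z(t) = w(t + 1)`, `t ≥ -1`, solves the neutral type equation and has initial state
`ξ₀ = (w(1) - A₁ w(0), w(1 + ·))`. -/
def System.InitialRelation {n : ℕ} (S : System n) (ξ₀ x₀ : M₂ n) : Prop :=
  ∃ (x : ℝ → M₂ n) (z z' : ℝ → E n),
    IsMildSolution S.opAt x₀ x ∧
    (∀ t, -1 ≤ t → z t = (x (t + 1)).fst) ∧
    S.IsSolution z z' ∧
    S.IsState ξ₀ z z'

end Neutral

/-! A function φ of `H¹` is encoded by `y = (φ(-1), φ')` in `M₂`, so that `prim y = φ`. Sending `y`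
to the state of φ is an isomorphism of `M₂` onto `X₁`: the graph norm controls φ and φ' in `L₂`,
hence also φ(-1). It remains to express the related initial datum through `y`. It is `trans y =
(φ(-1), ψ)` with ψ(θ) = φ'(-1-θ) - A₂(θ)φ(-1) - ∫_θ^0 [A₂(s)φ'(-1-θ+s) + A₃(s)φ(-1-θ+s)] ds, where
the lower limit θ comes from extending φ and φ' by zero outside (-1, 0].

Invertibility (`trans_bijective`): after the reflection θ ↦ -1-θ, ψ becomes (1 - N)φ' minus a term
that depends on φ(-1) only. N is a Volterra operator, its powers decay factorially, and 1 - N is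
invertible.

Existence (`initialRelation_trans`): on each interval of length one the neutral equation says that
`trans` of the unknown piece is a given element, so it is solvable, and the pieces are glued. Let
y(t) encode z(t+·). By `trans_mem_graphAt`, the boundary condition of `𝒜~` for the integrated
trajectory is the equation integrated over (0, t), so `trans (y(t))` is a mild solution, and its
first component is z(t-1).

Uniqueness (`initial_eq_of_fst_eq`): the state ξ₀ fixes z on [-1, 0], that is, w on [0, 1]. The
difference of two mild solutions with the same w has a second component that is merely transported
to the right, and w = 0 says that nothing leaves through θ = 0. Since everything would have left
within one unit of time, the initial difference is zero. -/

namespace Neutral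

/-! ### Correlations of an `L₂` kernel with an `L₂` function. -/

section Correlation

variable {n : ℕ}

/-- The correlation `c ↦ ∫_{-1}^0 K(s) g(c + s) ds` of an operator kernel with a function. -/
noncomputable def corr (K : ℝ → E n →L[ℝ] E n) (g : ℝ → E n) (c : ℝ) : E n :=
  ∫ s, K s (g (c + s)) ∂μ

variable {K : ℝ → E n →L[ℝ] E n} {g h : ℝ → E n}

theorem memLp_comp_add_left (hg : MemLp g 2 volume) (c : ℝ) :
    MemLp (fun s => g (c + s)) 2 volume :=
  hg.comp_measurePreserving (measurePreserving_add_left volume c)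

theorem integrable_corr (hK : MemLp K 2 μ) (hg : MemLp g 2 volume) (c : ℝ) :
    Integrable (fun s => K s (g (c + s))) μ :=
  memLp_one_iff_integrable.1 <|
    (ContinuousLinearMap.id ℝ (E n →L[ℝ] E n)).memLp_of_bilin 1 hK
      ((memLp_comp_add_left hg c).restrict _)

theorem corr_congr (hgh : g =ᵐ[volume] h) (c : ℝ) : corr K g c = corr K h c := by
  refine integral_congr_ae (ae_restrict_of_ae ?_)
  filter_upwards [(measurePreserving_add_left volume c).quasiMeasurePreserving.ae_eq_comp hgh]
    with s hs
  exact congrArg (K s) hs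

theorem corr_add (hK : MemLp K 2 μ) (hg : MemLp g 2 volume) (hh : MemLp h 2 volume) (c : ℝ) :
    corr K (g + h) c = corr K g c + corr K h c := by
  simp only [corr, Pi.add_apply, map_add]
  exact integral_add (integrable_corr hK hg c) (integrable_corr hK hh c)

theorem corr_smul (a : ℝ) (c : ℝ) : corr K (a • g) c = a • corr K g c := by
  simp only [corr, Pi.smul_apply, map_smul]
  exact integral_smul _ _

theorem aestronglyMeasurable_corr (hK : AEStronglyMeasurable K μ)
    (hg : AEStronglyMeasurable g volume) : AEStronglyMeasurable (corr K g) volume := by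
  have h1 : AEStronglyMeasurable (fun p : ℝ × ℝ => K p.2) ((volume : Measure ℝ).prod μ) :=
    hK.comp_quasiMeasurePreserving Measure.quasiMeasurePreserving_snd
  have h2 : AEStronglyMeasurable (fun p : ℝ × ℝ => g (p.1 + p.2)) ((volume : Measure ℝ).prod μ) := by
    refine hg.comp_quasiMeasurePreserving ?_
    refine (quasiMeasurePreserving_add volume volume).mono_left ?_
    exact Measure.AbsolutelyContinuous.prod Measure.AbsolutelyContinuous.rfl
      Measure.absolutelyContinuous_restrict
  exact ((ContinuousLinearMap.id ℝ (E n →L[ℝ] E n)).aestronglyMeasurable_comp₂ h1 h2).integral_prod_right'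

/-- Cauchy–Schwarz at a fixed point; the correlation is thus defined everywhere, not only almost
everywhere. -/
theorem enorm_corr_le (hK : AEStronglyMeasurable K μ) (hg : AEStronglyMeasurable g volume) (c : ℝ) :
    ‖corr K g c‖ₑ ≤ eLpNorm K 2 μ * eLpNorm (fun s => g (c + s)) 2 μ := by
  have h2 : AEStronglyMeasurable (fun s => g (c + s)) μ :=
    (hg.comp_measurePreserving (measurePreserving_add_left volume c)).restrict
  calc ‖corr K g c‖ₑ ≤ ∫⁻ s, ‖K s (g (c + s))‖ₑ ∂μ := enorm_integral_le_lintegral_enorm _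
    _ = eLpNorm (fun s => K s (g (c + s))) 1 μ := eLpNorm_one_eq_lintegral_enorm.symm
    _ ≤ (1 : NNReal) * eLpNorm K 2 μ * eLpNorm (fun s => g (c + s)) 2 μ := by
      refine eLpNorm_le_eLpNorm_mul_eLpNorm_of_nnnorm hK h2 (fun T v => T v) 1 ?_
      refine Filter.Eventually.of_forall fun s => ?_
      rw [one_mul]
      exact (K s).le_opNNNorm _
    _ = _ := by simp

/-- The bound on a correlation at `c` only sees the values on `(c - 1, c]`. -/
theorem enorm_corr_le_restrict (hK : AEStronglyMeasurable K μ) (hg : AEStronglyMeasurable g volume)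
    (c : ℝ) :
    ‖corr K g c‖ₑ ≤ eLpNorm K 2 μ * eLpNorm g 2 (volume.restrict (Ioc (c - 1) c)) := by
  refine (enorm_corr_le hK hg c).trans_eq ?_
  have h := (measurePreserving_add_left volume c).restrict_preimage
    (measurableSet_Ioc (a := c - 1) (b := c))
  have h5 : (fun x => c + x) ⁻¹' Ioc (c - 1) c = Ioc (-1) 0 := by
    ext s
    simp only [mem_preimage, mem_Ioc]
    constructor <;> intro h <;> constructor <;> linarith [h.1, h.2]
  rw [h5] at h
  rw [← eLpNorm_comp_measurePreserving hg.restrict h]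
  rfl

theorem enorm_corr_le' (hK : AEStronglyMeasurable K μ) (hg : AEStronglyMeasurable g volume) (c : ℝ) :
    ‖corr K g c‖ₑ ≤ eLpNorm K 2 μ * eLpNorm g 2 volume := by
  refine (enorm_corr_le hK hg c).trans ?_
  gcongr
  refine (eLpNorm_mono_measure _ Measure.restrict_le_self).trans_eq ?_
  exact eLpNorm_comp_measurePreserving hg (measurePreserving_add_left volume c)

end Correlation

/-! ### Extension by zero and correlation operators on `L₂(-1, 0)`. -/

section Extension

variable {n : ℕ}

instance : IsProbabilityMeasure μ := ⟨by simp⟩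

/-- A bounded operator into `L₂` from a pointwise formula. -/
noncomputable def toL2 {F : Type*} [NormedAddCommGroup F] [NormedSpace ℝ F]
    (T : F →ₗ[ℝ] (ℝ → E n)) (C : ℝ) (hm : ∀ f, AEStronglyMeasurable (T f) μ)
    (hC : ∀ f, ∀ᵐ θ ∂μ, ‖T f θ‖ ≤ C * ‖f‖) : F →L[ℝ] Lp (E n) 2 μ :=
  LinearMap.mkContinuous
    { toFun := fun f => (MemLp.of_bound (hm f) _ (hC f) : MemLp (T f) 2 μ).toLp
      map_add' := fun f g => by
        rw [← MemLp.toLp_add]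
        exact MemLp.toLp_congr _ _ (by rw [map_add])
      map_smul' := fun c f => by
        rw [RingHom.id_apply, ← MemLp.toLp_const_smul]
        exact MemLp.toLp_congr _ _ (by rw [map_smul]) } |C| (fun f => by
    have h := Lp.norm_le_of_ae_bound (p := 2) (μ := μ)
      (f := (MemLp.of_bound (hm f) _ (hC f) : MemLp (T f) 2 μ).toLp) (C := |C| * ‖f‖)
      (by positivity) (by
        filter_upwards [hC f, (MemLp.of_bound (hm f) _ (hC f) : MemLp (T f) 2 μ).coeFn_toLp]
          with θ h1 h2
        rw [h2]
        exact h1.trans (by gcongr; exact le_abs_self C))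
    have h1 : measureUnivNNReal μ = 1 := by simp [measureUnivNNReal]
    simpa [h1] using h)

theorem coeFn_toL2 {F : Type*} [NormedAddCommGroup F] [NormedSpace ℝ F]
    (T : F →ₗ[ℝ] (ℝ → E n)) (C : ℝ) (hm : ∀ f, AEStronglyMeasurable (T f) μ)
    (hC : ∀ f, ∀ᵐ θ ∂μ, ‖T f θ‖ ≤ C * ‖f‖) (f : F) : toL2 T C hm hC f =ᵐ[μ] T f :=
  MemLp.coeFn_toLp (MemLp.of_bound (hm f) _ (hC f))

/-- Extension by zero outside `(-1, 0]`. -/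
noncomputable def ext0 (f : ℝ → E n) : ℝ → E n := indicator (Ioc (-1) 0) f

theorem ext0_of_mem {f : ℝ → E n} {θ : ℝ} (h : θ ∈ Ioc (-1 : ℝ) 0) : ext0 f θ = f θ :=
  indicator_of_mem h f

theorem ext0_of_notMem {f : ℝ → E n} {θ : ℝ} (h : θ ∉ Ioc (-1 : ℝ) 0) : ext0 f θ = 0 :=
  indicator_of_notMem h f

theorem ext0_add (f g : ℝ → E n) : ext0 (f + g) = ext0 f + ext0 g := indicator_add' _ _ _

theorem ext0_smul (c : ℝ) (f : ℝ → E n) : ext0 (c • f) = c • ext0 f :=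
  indicator_const_smul (Ioc (-1) 0) c f

theorem memLp_ext0 {f : ℝ → E n} (hf : MemLp f 2 μ) : MemLp (ext0 f) 2 volume :=
  (memLp_indicator_iff_restrict measurableSet_Ioc).2 hf

theorem ext0_congr {f g : ℝ → E n} (h : f =ᵐ[μ] g) : ext0 f =ᵐ[volume] ext0 g :=
  (ae_eq_restrict_iff_indicator_ae_eq measurableSet_Ioc).1 h

theorem eLpNorm_ext0 (f : ℝ → E n) : eLpNorm (ext0 f) 2 volume = eLpNorm f 2 μ :=
  eLpNorm_indicator_eq_eLpNorm_restrict measurableSet_Ioc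

theorem Lp.memLp_ext0 (f : Lp (E n) 2 μ) : MemLp (ext0 f) 2 volume :=
  Neutral.memLp_ext0 (Lp.memLp f)

/-- The operator `f ↦ (θ ↦ ∫_{-1}^0 K(s) f(b - θ + s) ds)` of `L₂(-1, 0)`, where `f` is extended
by zero. -/
noncomputable def corrL (K : ℝ → E n →L[ℝ] E n) (hK : MemLp K 2 μ) (b : ℝ) :
    Lp (E n) 2 μ →L[ℝ] Lp (E n) 2 μ :=
  toL2
    { toFun := fun f θ => corr K (ext0 f) (b - θ)
      map_add' := fun f g => by
        funext θ
        rw [corr_congr (ext0_congr (Lp.coeFn_add f g)), ext0_add]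
        exact corr_add hK (Lp.memLp_ext0 f) (Lp.memLp_ext0 g) _
      map_smul' := fun c f => by
        funext θ
        rw [corr_congr (ext0_congr (Lp.coeFn_smul c f)), ext0_smul]
        exact corr_smul _ _ } (eLpNorm K 2 μ).toReal
    (fun f => ((aestronglyMeasurable_corr hK.1 (Lp.memLp_ext0 f).1).comp_measurePreserving
      (Measure.measurePreserving_sub_left volume b)).restrict)
    (fun f => Filter.Eventually.of_forall fun θ => by
      have h := enorm_corr_le' hK.1 (Lp.memLp_ext0 f).1 (b - θ)
      have h2 := ENNReal.toReal_mono (ENNReal.mul_ne_top hK.2.ne (Lp.memLp_ext0 f).2.ne) h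
      rwa [ENNReal.toReal_mul, toReal_enorm, eLpNorm_ext0] at h2)

theorem coeFn_corrL {K : ℝ → E n →L[ℝ] E n} (hK : MemLp K 2 μ) (b : ℝ) (f : Lp (E n) 2 μ) :
    corrL K hK b f =ᵐ[μ] fun θ => corr K (ext0 f) (b - θ) :=
  coeFn_toL2 _ _ _ _ f

end Extension

/-! ### Primitives, and functions of `H¹` encoded by initial value and derivative. -/

section Primitive

variable {n : ℕ}

theorem integrable_ext0 {f : ℝ → E n} (hf : MemLp f 2 μ) : Integrable (ext0 f) volume :=
  (integrable_indicator_iff measurableSet_Ioc).2 (hf.integrable (by norm_num))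

theorem intervalIntegrable_ext0 {f : ℝ → E n} (hf : MemLp f 2 μ) (a b : ℝ) :
    IntervalIntegrable (ext0 f) volume a b :=
  (integrable_ext0 hf).intervalIntegrable

theorem integral_ext0 (f : ℝ → E n) {a b : ℝ} (ha : -1 ≤ a) (hab : a ≤ b) (hb : b ≤ 0) :
    ∫ s in a..b, ext0 f s = ∫ s in a..b, f s := by
  refine intervalIntegral.integral_congr_uIoo fun s hs => ?_
  rw [uIoo_of_le hab] at hs
  exact ext0_of_mem ⟨by linarith [hs.1], by linarith [hs.2]⟩

theorem integral_ext0_of_le (f : ℝ → E n) {a b : ℝ} (ha : a ≤ -1) (hb : b ≤ -1) :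
    ∫ s in a..b, ext0 f s = 0 := by
  refine intervalIntegral.integral_zero_ae (Filter.Eventually.of_forall fun s hs => ?_)
  refine ext0_of_notMem fun h => ?_
  have := (mem_uIoc.1 hs)
  rcases this with h1 | h1 <;> linarith [h1.1, h1.2, h.1]

theorem IsH1On.mem_ext0 {f f' : ℝ → E n} (hf : IsH1On (-1) 0 f f') {x : ℝ}
    (hx : x ∈ Icc (-1 : ℝ) 0) : f x = f (-1) + ∫ s in (-1)..x, ext0 f' s := by
  rw [integral_ext0 f' le_rfl hx.1 hx.2]
  exact hf.eq_primitive x hx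

/-- A correlation with a function of `H¹`, extended by zero, is absolutely continuous. -/
theorem corr_ext0_eq_integral {K : ℝ → E n →L[ℝ] E n} (hK : MemLp K 2 μ) {f f' : ℝ → E n}
    (hf : IsH1On (-1) 0 f f') {θ : ℝ} (hθ : θ ∈ Icc (-1 : ℝ) 0) :
    corr K (ext0 f) (-1 - θ) =
      ∫ σ in θ..0, (K σ (f (-1)) + corr K (ext0 f') (-1 - σ)) := by
  have hf' := hf.memLp
  have hK1 : Integrable K μ := hK.integrable (by norm_num)
  -- The zero extension of `f` jumps by `f (-1)` at -1, and the argument -1-θ+s passes -1 at s = θ.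
  -- The jump produces the indicator, the absolutely continuous part the integral.
  have hpt : ∀ s ∈ Ioc (-1 : ℝ) 0, ext0 f (-1 - θ + s) =
      indicator (Ioi θ) (fun _ => f (-1)) s + ∫ σ in θ..0, ext0 f' (-1 - σ + s) := by
    intro s hs
    have h1 : ∫ σ in θ..0, ext0 f' (-1 - σ + s) = ∫ x in (s - 1)..(s - 1 - θ), ext0 f' x := by
      have := intervalIntegral.integral_comp_sub_left (a := θ) (b := 0) (ext0 f') (s - 1)
      rw [sub_zero] at this
      rw [← this]
      congr 1
      funext σ
      congr 1
      ring
    rw [h1]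
    by_cases h : θ < s
    · rw [indicator_of_mem (by exact h), ext0_of_mem ⟨by linarith, by linarith [hs.2, hθ.1]⟩,
        hf.mem_ext0 (x := -1 - θ + s) ⟨by linarith, by linarith [hs.2, hθ.1]⟩,
        ← intervalIntegral.integral_add_adjacent_intervals
          (intervalIntegrable_ext0 hf' (s - 1) (-1)) (intervalIntegrable_ext0 hf' (-1) _),
        integral_ext0_of_le f' (by linarith [hs.2]) le_rfl, zero_add]
      rw [show s - 1 - θ = -1 - θ + s by ring]
    · rw [indicator_of_notMem (by simpa using h), ext0_of_notMem (fun h' => h (by linarith [h'.1])),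
        integral_ext0_of_le f' (by linarith [hs.2]) (by linarith [not_lt.1 h]), zero_add]
  -- Fubini is justified by recognizing the integrand of the convolution of `K` with the reflection
  -- of `ext0 f'`, both integrable.
  have hint : Integrable (fun p : ℝ × ℝ => K p.2 (ext0 f' (-1 - p.1 + p.2)))
      ((volume.restrict (Ioc θ 0)).prod μ) := by
    have h := Integrable.convolution_integrand (ContinuousLinearMap.id ℝ (E n →L[ℝ] E n))
      (f := K) (ν := μ) (μ := volume) (g := fun x => ext0 f' (-1 - x)) hK1
      ((integrable_ext0 hf').comp_sub_left (-1))
    refine (h.mono_measure (Measure.prod_mono Measure.restrict_le_self le_rfl)).congr ?_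
    refine Filter.Eventually.of_forall fun p => ?_
    simp only [ContinuousLinearMap.coe_id', id_eq]
    congr 2
    ring
  have hcongr : corr K (ext0 f) (-1 - θ) = ∫ s, (indicator (Ioi θ) (fun s => K s (f (-1))) s +
      ∫ σ in Ioc θ 0, K s (ext0 f' (-1 - σ + s))) ∂μ := by
    refine setIntegral_congr_fun measurableSet_Ioc fun s hs => ?_
    simp only [hpt s hs, map_add]
    congr 1
    · by_cases h : s ∈ Ioi θ
      · simp [h]
      · simp [h]
    · rw [← intervalIntegral.integral_of_le hθ.2,
        ContinuousLinearMap.intervalIntegral_comp_comm]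
      have h := (integrable_ext0 hf').comp_sub_left (s - 1)
      refine (h.congr (Filter.Eventually.of_forall fun σ => ?_)).intervalIntegrable
      change ext0 f' _ = ext0 f' _
      congr 1
      ring
  have hKv : Integrable (fun s => K s (f (-1))) μ := hK1.apply_continuousLinearMap _
  have hIoc : Ioc (-1 : ℝ) 0 ∩ Ioi θ = Ioc θ 0 := by
    ext s
    simp only [mem_inter_iff, mem_Ioc, mem_Ioi]
    exact ⟨fun h => ⟨h.2, h.1.2⟩, fun h => ⟨⟨by linarith [hθ.1, h.1], h.2⟩, h.1⟩⟩
  have hθK : IntervalIntegrable (fun s => K s (f (-1))) volume θ 0 := by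
    rw [intervalIntegrable_iff_integrableOn_Ioc_of_le hθ.2]
    exact IntegrableOn.mono_set hKv (Ioc_subset_Ioc_left hθ.1)
  have hcorr : IntervalIntegrable (fun σ => corr K (ext0 f') (-1 - σ)) volume θ 0 := by
    rw [intervalIntegrable_iff_integrableOn_Ioc_of_le hθ.2]
    exact hint.integral_prod_left
  have hint' : Integrable (fun s => ∫ σ in Ioc θ 0, K s (ext0 f' (-1 - σ + s))) μ :=
    hint.swap.integral_prod_left
  rw [hcongr, integral_add (hKv.indicator measurableSet_Ioi) hint',
    intervalIntegral.integral_add hθK hcorr, setIntegral_indicator measurableSet_Ioi, hIoc,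
    ← intervalIntegral.integral_of_le hθ.2]
  congr 1
  rw [integral_integral_swap (f := fun s σ => K s (ext0 f' (-1 - σ + s))) hint.swap,
    intervalIntegral.integral_of_le hθ.2]
  rfl

/-- The function with the initial value `y.fst` at `-1` and the derivative `y.snd`. -/
noncomputable def prim (y : M₂ n) (θ : ℝ) : E n := y.fst + ∫ s in (-1)..θ, ext0 y.snd s

@[simp]
theorem prim_neg_one (y : M₂ n) : prim y (-1) = y.fst := by simp [prim]

theorem isH1On_prim (y : M₂ n) : IsH1On (-1) 0 (prim y) y.snd where
  memLp := Lp.memLp y.snd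
  eq_primitive θ hθ := by
    rw [prim_neg_one, ← integral_ext0 _ le_rfl hθ.1 hθ.2]
    rfl

theorem IsH1On.eq_prim {f f' : ℝ → E n} (hf : IsH1On (-1) 0 f f') {y : M₂ n}
    (h1 : y.fst = f (-1)) (h2 : y.snd =ᵐ[μ] f') {θ : ℝ} (hθ : θ ∈ Icc (-1 : ℝ) 0) :
    f θ = prim y θ := by
  rw [hf.mem_ext0 hθ, prim, h1]
  congr 1
  exact intervalIntegral.integral_congr_ae ((ext0_congr h2).mono fun s hs _ => hs.symm)

theorem prim_add (y y' : M₂ n) (θ : ℝ) : prim (y + y') θ = prim y θ + prim y' θ := by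
  have h : ∫ s in (-1)..θ, ext0 (y + y').snd s =
      ∫ s in (-1)..θ, (ext0 y.snd s + ext0 y'.snd s) := by
    refine intervalIntegral.integral_congr_ae ?_
    filter_upwards [ext0_congr (Lp.coeFn_add y.snd y'.snd)] with s hs _
    rw [WithLp.add_snd, hs, ext0_add, Pi.add_apply]
  rw [prim, h, intervalIntegral.integral_add (intervalIntegrable_ext0 (Lp.memLp _) _ _)
    (intervalIntegrable_ext0 (Lp.memLp _) _ _), WithLp.add_fst, prim, prim]
  abel

theorem prim_smul (c : ℝ) (y : M₂ n) (θ : ℝ) : prim (c • y) θ = c • prim y θ := by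
  have h : ∫ s in (-1)..θ, ext0 (c • y).snd s = ∫ s in (-1)..θ, c • ext0 y.snd s := by
    refine intervalIntegral.integral_congr_ae ?_
    filter_upwards [ext0_congr (Lp.coeFn_smul c y.snd)] with s hs _
    rw [WithLp.smul_snd, hs, ext0_smul, Pi.smul_apply]
  rw [prim, h, intervalIntegral.integral_smul, WithLp.smul_fst, prim, smul_add]

theorem integral_norm_ext0_le (q : Lp (E n) 2 μ) : ∫ s, ‖ext0 q s‖ ≤ ‖q‖ := by
  have h1 : eLpNorm q 1 μ ≤ eLpNorm q 2 μ :=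
    eLpNorm_le_eLpNorm_of_exponent_le (by norm_num) (Lp.aestronglyMeasurable q)
  have h2 : eLpNorm (ext0 q) 1 volume = eLpNorm q 1 μ :=
    eLpNorm_indicator_eq_eLpNorm_restrict measurableSet_Ioc
  rw [integral_norm_eq_lintegral_enorm (integrable_ext0 (Lp.memLp q)).1,
    ← eLpNorm_one_eq_lintegral_enorm, h2]
  exact ENNReal.toReal_mono (Lp.eLpNorm_ne_top q) h1

theorem norm_prim_le (y : M₂ n) (θ : ℝ) : ‖prim y θ‖ ≤ 2 * ‖y‖ := by
  have h1 : ‖∫ s in (-1)..θ, ext0 y.snd s‖ ≤ ‖y.snd‖ := by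
    refine (intervalIntegral.norm_integral_le_integral_norm_uIoc).trans ?_
    refine (setIntegral_le_integral (integrable_ext0 (Lp.memLp _)).norm
      (Filter.Eventually.of_forall fun s => norm_nonneg _)).trans ?_
    exact integral_norm_ext0_le _
  have h2 := WithLp.norm_fst_le _ y
  have h3 := WithLp.norm_snd_le _ y
  have h4 := norm_add_le y.fst (∫ s in (-1)..θ, ext0 y.snd s)
  rw [prim]
  linarith

theorem continuous_prim (y : M₂ n) : Continuous (prim y) :=
  continuous_const.add (intervalIntegral.continuous_primitive
    (fun a b => intervalIntegrable_ext0 (Lp.memLp _) a b) (-1))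

/-- Evaluation of `prim` at a point. -/
noncomputable def primAt (θ : ℝ) : M₂ n →L[ℝ] E n :=
  LinearMap.mkContinuous
    { toFun := fun y => prim y θ
      map_add' := fun y y' => prim_add y y' θ
      map_smul' := fun c y => prim_smul c y θ } 2 fun y => norm_prim_le y θ

@[simp]
theorem primAt_apply (θ : ℝ) (y : M₂ n) : primAt θ y = prim y θ := rfl

/-- `prim` as an operator into `L₂`. -/
noncomputable def primL : M₂ n →L[ℝ] Lp (E n) 2 μ :=
  toL2
    { toFun := prim
      map_add' := fun y y' => funext (prim_add y y')
      map_smul' := fun c y => funext (prim_smul c y) } 2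
    (fun y => (continuous_prim y).aestronglyMeasurable)
    (fun y => Filter.Eventually.of_forall (norm_prim_le y))

theorem coeFn_primL (y : M₂ n) : primL y =ᵐ[μ] prim y := coeFn_toL2 _ _ _ _ y

end Primitive

/-! ### Volterra operators and invertibility of `1 - N`. -/

section Volterra

variable {n : ℕ}

theorem eLpNorm_two_sq {α F : Type*} [MeasurableSpace α] [NormedAddCommGroup F] (f : α → F)
    (ν : Measure α) : eLpNorm f 2 ν ^ 2 = ∫⁻ x, ‖f x‖ₑ ^ 2 ∂ν := by
  have := eLpNorm_nnreal_pow_eq_lintegral (f := f) (μ := ν) (p := 2) (by norm_num)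
  simpa using this

theorem integral_pow_div_factorial (a : ℝ) (m : ℕ) (τ : ℝ) :
    ∫ σ in (-1)..τ, a * ((a * (σ + 1)) ^ m / m.factorial) =
      (a * (τ + 1)) ^ (m + 1) / (m + 1).factorial := by
  have h : ∀ σ ∈ uIcc (-1) τ, HasDerivAt
      (fun σ : ℝ => (a * (σ + 1)) ^ (m + 1) / (m + 1).factorial)
      (a * ((a * (σ + 1)) ^ m / m.factorial)) σ := by
    intro σ _
    have h1 : HasDerivAt (fun σ : ℝ => a * (σ + 1)) a σ := by
      simpa using ((hasDerivAt_id σ).add_const 1).const_mul a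
    refine ((h1.fun_pow (m + 1)).div_const ((m + 1).factorial : ℝ)).congr_deriv ?_
    have : (m.factorial : ℝ) ≠ 0 := by positivity
    rw [Nat.factorial_succ]
    push_cast
    field_simp
  rw [intervalIntegral.integral_eq_sub_of_hasDerivAt h (by
    apply Continuous.intervalIntegrable; fun_prop)]
  simp

/-- A Volterra operator: its values at `τ` are controlled by the argument on `(-1, τ]`. -/
def IsVolterra (k : NNReal) (N : Lp (E n) 2 μ →L[ℝ] Lp (E n) 2 μ) : Prop :=
  ∀ q, ∀ᵐ τ ∂μ, ‖N q τ‖ₑ ≤ k * eLpNorm q 2 (volume.restrict (Ioc (-1) τ))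

/-- Squaring the Volterra bound and integrating it over (-1, τ] turns the estimate for `N ^ m` into
the one for `N ^ (m + 1)`; the iterated integrals of 1 give the factorial. -/
theorem IsVolterra.eLpNorm_pow_sq_le {k : NNReal} {N : Lp (E n) 2 μ →L[ℝ] Lp (E n) 2 μ}
    (hN : IsVolterra k N) (m : ℕ) (q : Lp (E n) 2 μ) {τ : ℝ} (hτ : τ ∈ Icc (-1 : ℝ) 0) :
    eLpNorm ((N ^ m) q) 2 (volume.restrict (Ioc (-1) τ)) ^ 2 ≤
      ENNReal.ofReal (((k : ℝ) ^ 2 * (τ + 1)) ^ m / m.factorial) * ‖q‖ₑ ^ 2 := by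
  induction m generalizing τ with
  | zero =>
    simp only [pow_zero, Nat.factorial_zero, Nat.cast_one, div_one, ENNReal.ofReal_one, one_mul,
      one_apply_eq_self]
    rw [Lp.enorm_def]
    gcongr
    exact Measure.restrict_mono (Ioc_subset_Ioc_right hτ.2) le_rfl
  | succ m ih =>
    have hsub : Ioc (-1 : ℝ) τ ⊆ Ioc (-1) 0 := Ioc_subset_Ioc_right hτ.2
    have hk : (k : ENNReal) ^ 2 = ENNReal.ofReal ((k : ℝ) ^ 2) := by
      rw [ENNReal.ofReal_pow k.coe_nonneg, ENNReal.ofReal_coe_nnreal]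
    calc eLpNorm ((N ^ (m + 1)) q) 2 (volume.restrict (Ioc (-1) τ)) ^ 2
        = ∫⁻ σ in Ioc (-1) τ, ‖N ((N ^ m) q) σ‖ₑ ^ 2 := by
          rw [eLpNorm_two_sq, pow_succ']
          rfl
      _ ≤ ∫⁻ σ in Ioc (-1) τ, ENNReal.ofReal
            ((k : ℝ) ^ 2 * (((k : ℝ) ^ 2 * (σ + 1)) ^ m / m.factorial)) * ‖q‖ₑ ^ 2 := by
          refine lintegral_mono_ae ?_
          filter_upwards [ae_restrict_of_ae_restrict_of_subset hsub (hN ((N ^ m) q)),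
            ae_restrict_mem measurableSet_Ioc] with σ h1 h2
          calc _ ≤ (k * eLpNorm ((N ^ m) q) 2 (volume.restrict (Ioc (-1) σ))) ^ 2 := by gcongr
            _ = (k : ENNReal) ^ 2 * eLpNorm ((N ^ m) q) 2 (volume.restrict (Ioc (-1) σ)) ^ 2 :=
              mul_pow _ _ _
            _ ≤ (k : ENNReal) ^ 2 * (ENNReal.ofReal (((k : ℝ) ^ 2 * (σ + 1)) ^ m / m.factorial)
                * ‖q‖ₑ ^ 2) := by
              gcongr
              exact ih ⟨h2.1.le, h2.2.trans hτ.2⟩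
            _ = _ := by rw [hk, ← mul_assoc, ← ENNReal.ofReal_mul (by positivity)]
      _ = ENNReal.ofReal (∫ σ in Ioc (-1) τ,
            (k : ℝ) ^ 2 * (((k : ℝ) ^ 2 * (σ + 1)) ^ m / m.factorial)) * ‖q‖ₑ ^ 2 := by
          rw [lintegral_mul_const _ (by fun_prop), ofReal_integral_eq_lintegral_ofReal]
          · exact (Continuous.integrableOn_Icc (by fun_prop)).mono_set Ioc_subset_Icc_self
          · filter_upwards [ae_restrict_mem measurableSet_Ioc] with σ h2
            have : 0 ≤ σ + 1 := by linarith [h2.1]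
            positivity
      _ = _ := by
          rw [← intervalIntegral.integral_of_le hτ.1, integral_pow_div_factorial]

/-- Some power of `N` is a strict contraction, and `1 - N` is a factor of `1 - N ^ m` that commutes
with the cofactor, a geometric sum. -/
theorem IsVolterra.isUnit_one_sub {k : NNReal} {N : Lp (E n) 2 μ →L[ℝ] Lp (E n) 2 μ}
    (hN : IsVolterra k N) : IsUnit (1 - N) := by
  -- The estimate at τ = 0 concerns squared norms, so 1/4 here gives `‖N ^ m‖ ≤ 1 / 2`.
  obtain ⟨m, hm⟩ := ((FloorSemiring.tendsto_pow_div_factorial_atTop ((k : ℝ) ^ 2)).eventually_lt_const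
    (show (0 : ℝ) < 1 / 4 by norm_num)).exists
  have h1 : ‖N ^ m‖ ≤ 1 / 2 := by
    refine ContinuousLinearMap.opNorm_le_bound _ (by norm_num) fun q => ?_
    have h := hN.eLpNorm_pow_sq_le m q (τ := 0) (by norm_num)
    rw [← Lp.enorm_def, ← ofReal_norm, ← ofReal_norm, ← ENNReal.ofReal_pow (norm_nonneg _),
      ← ENNReal.ofReal_pow (norm_nonneg _), ← ENNReal.ofReal_mul (by positivity),
      ENNReal.ofReal_le_ofReal_iff (by positivity)] at h
    rw [zero_add, mul_one] at h
    refine abs_le_of_sq_le_sq' ?_ (by positivity) |>.2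
    nlinarith [sq_nonneg ‖q‖]
  have h2 : IsUnit (1 - N ^ m) := isUnit_one_sub_of_norm_lt_one (by linarith)
  rw [← mul_neg_geom_sum] at h2
  have hc : Commute (1 - N) (∑ i ∈ Finset.range m, N ^ i) := by
    change _ * _ = _ * _
    rw [mul_neg_geom_sum, geom_sum_mul_neg]
  exact (hc.isUnit_mul_iff.1 h2).1

end Volterra

/-! ### Matrix kernels, the reflection of `L₂(-1, 0)`, and bounds for primitives. -/

section Kernel

variable {n : ℕ}

/-- A matrix function as an operator-valued function. -/
noncomputable def kernel (M : ℝ → Matrix (Fin n) (Fin n) ℝ) (θ : ℝ) : E n →L[ℝ] E n :=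
  Matrix.toEuclideanCLM (𝕜 := ℝ) (M θ)

theorem kernel_apply (M : ℝ → Matrix (Fin n) (Fin n) ℝ) (θ : ℝ) (v : E n) :
    kernel M θ v = app (M θ) v := rfl

theorem memLp_sum_smul {F : Type*} [NormedAddCommGroup F] [NormedSpace ℝ F]
    {f : ℝ → Matrix (Fin n) (Fin n) ℝ} (hf : ∀ i j, MemLp (fun θ => f θ i j) 2 μ)
    (T : Fin n → Fin n → F) : MemLp (fun θ => ∑ i, ∑ j, f θ i j • T i j) 2 μ :=
  memLp_finsetSum _ fun i _ => memLp_finsetSum _ fun j _ =>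
    ((ContinuousLinearMap.id ℝ ℝ).smulRight (T i j)).comp_memLp' (hf i j)

theorem memLp_kernel {M : ℝ → Matrix (Fin n) (Fin n) ℝ}
    (hM : ∀ i j, MemLp (fun θ => M θ i j) 2 μ) : MemLp (kernel M) 2 μ := by
  have h : kernel M = fun θ => ∑ i, ∑ j,
      M θ i j • Matrix.toEuclideanCLM (𝕜 := ℝ) (Matrix.single i j (1 : ℝ)) := by
    funext θ
    rw [kernel]
    conv_lhs => rw [Matrix.matrix_eq_sum_single (M θ)]
    simp only [map_sum]
    refine Finset.sum_congr rfl fun i _ => Finset.sum_congr rfl fun j _ => ?_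
    rw [← map_smul, Matrix.smul_single, smul_eq_mul, mul_one]
  rw [h]
  exact memLp_sum_smul hM _

theorem memLp_apply_const {K : ℝ → E n →L[ℝ] E n} (hK : MemLp K 2 μ) (v : E n) :
    MemLp (fun θ => K θ v) 2 μ :=
  (ContinuousLinearMap.apply ℝ (E n) v).comp_memLp' hK

/-- The operator `v ↦ K(·) v` from `ℝⁿ` to `L₂`. -/
noncomputable def constL (K : ℝ → E n →L[ℝ] E n) (hK : MemLp K 2 μ) : E n →L[ℝ] Lp (E n) 2 μ :=
  LinearMap.toContinuousLinearMap
    { toFun := fun v => (memLp_apply_const hK v).toLp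
      map_add' := fun v w => by
        rw [← MemLp.toLp_add]
        exact MemLp.toLp_congr _ _ (Filter.Eventually.of_forall fun θ => map_add (K θ) v w)
      map_smul' := fun c v => by
        rw [RingHom.id_apply, ← MemLp.toLp_const_smul]
        exact MemLp.toLp_congr _ _ (Filter.Eventually.of_forall fun θ => map_smul (K θ) c v) }

theorem coeFn_constL {K : ℝ → E n →L[ℝ] E n} (hK : MemLp K 2 μ) (v : E n) :
    constL K hK v =ᵐ[μ] fun θ => K θ v :=
  MemLp.coeFn_toLp (memLp_apply_const hK v)

theorem measurePreserving_refl : MeasurePreserving (fun θ : ℝ => -1 - θ) μ μ := by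
  have h := (Measure.measurePreserving_sub_left volume (-1 : ℝ)).restrict_preimage
    (measurableSet_Ioc (a := (-1 : ℝ)) (b := 0))
  have h5 : (fun x : ℝ => -1 - x) ⁻¹' Ioc (-1) 0 = Ico (-1) 0 := by
    ext s
    simp only [mem_preimage, mem_Ioc, mem_Ico]
    constructor <;> intro h <;> constructor <;> linarith [h.1, h.2]
  rwa [h5, restrict_Ico_eq_restrict_Ioc] at h

/-- The reflection `q ↦ q(-1 - ·)` of `L₂(-1, 0)`. -/
noncomputable def reflL : Lp (E n) 2 μ →L[ℝ] Lp (E n) 2 μ :=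
  (Lp.compMeasurePreservingₗᵢ ℝ (fun θ : ℝ => -1 - θ)
    measurePreserving_refl).toContinuousLinearMap

theorem coeFn_reflL (q : Lp (E n) 2 μ) : reflL q =ᵐ[μ] fun θ => q (-1 - θ) :=
  Lp.coeFn_compMeasurePreserving q measurePreserving_refl

theorem reflL_reflL (q : Lp (E n) 2 μ) : reflL (reflL q) = q := by
  refine Lp.ext ((coeFn_reflL _).trans ?_)
  filter_upwards [measurePreserving_refl.quasiMeasurePreserving.ae_eq_comp (coeFn_reflL q)]
    with θ h
  simp only [Function.comp_apply] at h
  rw [h]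
  congr 1
  ring

/-- The inclusion of `L₂` in `M₂` as the second component. -/
noncomputable def inrL : Lp (E n) 2 μ →L[ℝ] M₂ n :=
  (WithLp.prodContinuousLinearEquiv 2 ℝ (E n) (Lp (E n) 2 μ)).symm.toContinuousLinearMap ∘L
    ContinuousLinearMap.inr ℝ (E n) (Lp (E n) 2 μ)

theorem eq_add_inrL (y : M₂ n) : y = WithLp.toLp 2 (y.fst, 0) + inrL y.snd := by
  refine WithLp.ofLp_injective 2 (Prod.ext ?_ ?_)
  · exact (add_zero y.fst).symm
  · exact (zero_add y.snd).symm

/-- The interval has length at most 1, so on it the `L₂` norm of the primitive is at most its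
supremum, which is at most the `L₁` and hence the `L₂` norm of `q`. Keeping τ makes the `A₃` term a
Volterra operator too. -/
theorem eLpNorm_prim_inrL_le (q : Lp (E n) 2 μ) {τ : ℝ} (hτ : τ ∈ Icc (-1 : ℝ) 0) :
    eLpNorm (prim (inrL q)) 2 (volume.restrict (Ioc (-1) τ)) ≤
      eLpNorm q 2 (volume.restrict (Ioc (-1) τ)) := by
  have hone : ∀ σ : ℝ, σ ≤ 0 → volume (Ioc (-1) σ) ≤ 1 := fun σ hσ => by
    rw [Real.volume_Ioc]
    exact ENNReal.ofReal_le_one.2 (by linarith)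
  have hq : AEStronglyMeasurable q μ := Lp.aestronglyMeasurable q
  have hb : ∀ σ ∈ Ioc (-1 : ℝ) τ, ‖prim (inrL q) σ‖ₑ ≤
      eLpNorm q 2 (volume.restrict (Ioc (-1) τ)) := by
    intro σ hσ
    have h1 : prim (inrL q) σ = ∫ s in Ioc (-1) σ, q s := by
      rw [prim, integral_ext0 _ le_rfl hσ.1.le (hσ.2.trans hτ.2),
        intervalIntegral.integral_of_le hσ.1.le]
      exact zero_add _
    rw [h1]
    calc ‖∫ s in Ioc (-1) σ, q s‖ₑ ≤ eLpNorm q 1 (volume.restrict (Ioc (-1) σ)) := by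
          rw [eLpNorm_one_eq_lintegral_enorm]
          exact enorm_integral_le_lintegral_enorm _
      _ ≤ eLpNorm q 1 (volume.restrict (Ioc (-1) τ)) :=
          eLpNorm_mono_measure _ (Measure.restrict_mono (Ioc_subset_Ioc_right hσ.2) le_rfl)
      _ ≤ eLpNorm q 2 (volume.restrict (Ioc (-1) τ)) *
          (volume.restrict (Ioc (-1) τ)) univ ^ (1 / (1 : ENNReal).toReal - 1 / (2 : ENNReal).toReal) :=
          eLpNorm_le_eLpNorm_mul_rpow_measure_univ (by norm_num)
            (hq.mono_measure (Measure.restrict_mono (Ioc_subset_Ioc_right hτ.2) le_rfl))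
      _ ≤ eLpNorm q 2 (volume.restrict (Ioc (-1) τ)) * 1 := by
          gcongr
          rw [Measure.restrict_apply_univ]
          exact ENNReal.rpow_le_one (hone τ hτ.2) (by norm_num)
      _ = _ := mul_one _
  have h2 := eLpNorm_le_of_ae_enorm_bound (p := 2) (μ := volume.restrict (Ioc (-1) τ))
    ((ae_restrict_iff' measurableSet_Ioc).2 (Filter.Eventually.of_forall hb))
  refine h2.trans ?_
  rw [Measure.restrict_apply_univ, smul_eq_mul]
  exact mul_le_of_le_one_right' (ENNReal.rpow_le_one (hone τ hτ.2) (by simp))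

theorem eLpNorm_ext0_restrict_le (f : ℝ → E n) {τ : ℝ} :
    eLpNorm (ext0 f) 2 (volume.restrict (Ioc (τ - 1) τ)) ≤
      eLpNorm f 2 (volume.restrict (Ioc (-1) τ)) := by
  rw [ext0, eLpNorm_indicator_eq_eLpNorm_restrict measurableSet_Ioc,
    Measure.restrict_restrict measurableSet_Ioc]
  refine eLpNorm_mono_measure _ (Measure.restrict_mono (fun s hs => ?_) le_rfl)
  exact ⟨hs.1.1, hs.2.2⟩

theorem memLp_prim (y : M₂ n) : MemLp (prim y) 2 μ := (isH1On_prim y).memLp_self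

end Kernel

/-! ### The transformation `trans` and its invertibility. -/

namespace System

variable {n : ℕ} (S : System n)

/-- The second component of the transformation between the two state spaces. -/
noncomputable def transSnd : M₂ n →L[ℝ] Lp (E n) 2 μ :=
  reflL ∘L WithLp.sndL 2 ℝ (E n) (Lp (E n) 2 μ)
    - constL (kernel S.A₂) (memLp_kernel S.memLp₂) ∘L WithLp.fstL 2 ℝ (E n) (Lp (E n) 2 μ)
    - corrL (kernel S.A₂) (memLp_kernel S.memLp₂) (-1) ∘L WithLp.sndL 2 ℝ (E n) (Lp (E n) 2 μ)
    - corrL (kernel S.A₃) (memLp_kernel S.memLp₃) (-1) ∘L primL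

/-- The transformation between the two state spaces, with a function `φ` of `H¹` given by
`φ(-1)` and `φ'`. -/
noncomputable def trans : M₂ n →L[ℝ] M₂ n :=
  (WithLp.prodContinuousLinearEquiv 2 ℝ (E n) (Lp (E n) 2 μ)).symm.toContinuousLinearMap ∘L
    (WithLp.fstL 2 ℝ (E n) (Lp (E n) 2 μ)).prod S.transSnd

@[simp]
theorem trans_fst (y : M₂ n) : (S.trans y).fst = y.fst := rfl

@[simp]
theorem trans_snd (y : M₂ n) : (S.trans y).snd = S.transSnd y := rfl

theorem transSnd_apply (y : M₂ n) : S.transSnd y = reflL y.snd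
    - constL (kernel S.A₂) (memLp_kernel S.memLp₂) y.fst
    - corrL (kernel S.A₂) (memLp_kernel S.memLp₂) (-1) y.snd
    - corrL (kernel S.A₃) (memLp_kernel S.memLp₃) (-1) (primL y) := rfl

theorem coeFn_transSnd (y : M₂ n) : S.transSnd y =ᵐ[μ] fun θ => y.snd (-1 - θ)
    - app (S.A₂ θ) y.fst - corr (kernel S.A₂) (ext0 y.snd) (-1 - θ)
    - corr (kernel S.A₃) (ext0 (prim y)) (-1 - θ) := by
  rw [transSnd_apply]
  filter_upwards [Lp.coeFn_sub (reflL y.snd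
      - constL (kernel S.A₂) (memLp_kernel S.memLp₂) y.fst
      - corrL (kernel S.A₂) (memLp_kernel S.memLp₂) (-1) y.snd)
      (corrL (kernel S.A₃) (memLp_kernel S.memLp₃) (-1) (primL y)),
    Lp.coeFn_sub (reflL y.snd - constL (kernel S.A₂) (memLp_kernel S.memLp₂) y.fst)
      (corrL (kernel S.A₂) (memLp_kernel S.memLp₂) (-1) y.snd),
    Lp.coeFn_sub (reflL y.snd) (constL (kernel S.A₂) (memLp_kernel S.memLp₂) y.fst),
    coeFn_reflL y.snd, coeFn_constL (memLp_kernel S.memLp₂) y.fst,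
    coeFn_corrL (memLp_kernel S.memLp₂) (-1) y.snd,
    coeFn_corrL (memLp_kernel S.memLp₃) (-1) (primL y)] with θ h1 h2 h3 h4 h5 h6 h7
  rw [h1, Pi.sub_apply, h2, Pi.sub_apply, h3, Pi.sub_apply, h4, h5, h6, h7, kernel_apply,
    corr_congr (ext0_congr (coeFn_primL y))]

/-- The Volterra operator of the transformation between the two state spaces. -/
noncomputable def volterra : Lp (E n) 2 μ →L[ℝ] Lp (E n) 2 μ :=
  reflL ∘L (corrL (kernel S.A₂) (memLp_kernel S.memLp₂) (-1) +
    corrL (kernel S.A₃) (memLp_kernel S.memLp₃) (-1) ∘L primL ∘L inrL)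

theorem coeFn_volterra (q : Lp (E n) 2 μ) : S.volterra q =ᵐ[μ] fun θ =>
    corr (kernel S.A₂) (ext0 q) θ + corr (kernel S.A₃) (ext0 (prim (inrL q))) θ := by
  refine (coeFn_reflL _).trans ?_
  have h : (corrL (kernel S.A₂) (memLp_kernel S.memLp₂) (-1) +
      corrL (kernel S.A₃) (memLp_kernel S.memLp₃) (-1) ∘L primL ∘L inrL) q =ᵐ[μ] fun θ =>
      corr (kernel S.A₂) (ext0 q) (-1 - θ) +
        corr (kernel S.A₃) (ext0 (prim (inrL q))) (-1 - θ) := by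
    filter_upwards [Lp.coeFn_add (corrL (kernel S.A₂) (memLp_kernel S.memLp₂) (-1) q)
        (corrL (kernel S.A₃) (memLp_kernel S.memLp₃) (-1) (primL (inrL q))),
      coeFn_corrL (memLp_kernel S.memLp₂) (-1) q,
      coeFn_corrL (memLp_kernel S.memLp₃) (-1) (primL (inrL q))] with θ h1 h2 h3
    refine h1.trans ?_
    rw [Pi.add_apply, h2, h3, corr_congr (ext0_congr (coeFn_primL (inrL q)))]
  filter_upwards [measurePreserving_refl.quasiMeasurePreserving.ae_eq_comp h] with θ h
  refine h.trans ?_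
  simp only [Function.comp_apply, sub_sub_cancel]

/-- A correlation at τ sees its argument on (τ-1, τ], and the extension by zero cuts this down to
(-1, τ]. -/
theorem isVolterra_volterra : IsVolterra
    ((eLpNorm (kernel S.A₂) 2 μ).toNNReal + (eLpNorm (kernel S.A₃) 2 μ).toNNReal) S.volterra := by
  intro q
  filter_upwards [S.coeFn_volterra q, ae_restrict_mem measurableSet_Ioc] with τ h hτ
  rw [h, ENNReal.coe_add, ENNReal.coe_toNNReal (memLp_kernel S.memLp₂).2.ne,
    ENNReal.coe_toNNReal (memLp_kernel S.memLp₃).2.ne, add_mul]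
  refine (enorm_add_le _ _).trans (add_le_add ?_ ?_)
  · refine (enorm_corr_le_restrict (memLp_kernel S.memLp₂).1 (Lp.memLp_ext0 q).1 τ).trans ?_
    gcongr
    exact eLpNorm_ext0_restrict_le q
  · refine (enorm_corr_le_restrict (memLp_kernel S.memLp₃).1
      (memLp_ext0 (memLp_prim (inrL q))).1 τ).trans ?_
    gcongr
    exact (eLpNorm_ext0_restrict_le _).trans (eLpNorm_prim_inrL_le q ⟨hτ.1.le, hτ.2⟩)

/-- Splitting φ into the constant φ(-1) and the primitive of φ' that vanishes at -1 separates the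
two components of `y`: the derivative enters only through `1 - S.volterra`. -/
theorem reflL_transSnd (y : M₂ n) : reflL (S.transSnd y) = (1 - S.volterra) y.snd -
    reflL (constL (kernel S.A₂) (memLp_kernel S.memLp₂) y.fst +
      corrL (kernel S.A₃) (memLp_kernel S.memLp₃) (-1) (primL (WithLp.toLp 2 (y.fst, 0)))) := by
  rw [transSnd_apply]
  have h : primL y = primL (WithLp.toLp 2 (y.fst, 0)) + primL (inrL y.snd) := by
    rw [← map_add, ← eq_add_inrL]
  rw [h]
  simp only [map_sub, map_add, reflL_reflL, volterra, sub_apply,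
    one_apply_eq_self, ContinuousLinearMap.comp_apply, add_apply]
  abel

/-- `trans` is triangular: it keeps the first component, and for a fixed first component the second
is affine in φ' with invertible linear part. -/
theorem trans_bijective : Function.Bijective S.trans := by
  have hu := S.isVolterra_volterra.isUnit_one_sub
  have hb : Function.Bijective ⇑(1 - S.volterra) :=
    (ContinuousLinearMap.isUnit_iff_bijective).1 hu
  constructor
  · refine (injective_iff_map_eq_zero _).2 fun y hy => ?_
    have h1 : y.fst = 0 := (congrArg WithLp.fst hy : _)
    have h2 : S.transSnd y = 0 := (congrArg WithLp.snd hy : _)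
    have h3 := S.reflL_transSnd y
    have h0 : (WithLp.toLp 2 ((0 : E n), (0 : Lp (E n) 2 μ))) = 0 := rfl
    rw [h2, h1, h0] at h3
    simp only [map_zero, add_zero, sub_zero] at h3
    have h4 : y.snd = 0 := hb.1 (by rw [← h3, map_zero])
    exact WithLp.ofLp_injective 2 (Prod.ext h1 h4)
  · intro w
    obtain ⟨q, hq⟩ := hb.2 (reflL w.snd +
      reflL (constL (kernel S.A₂) (memLp_kernel S.memLp₂) w.fst +
        corrL (kernel S.A₃) (memLp_kernel S.memLp₃) (-1) (primL (WithLp.toLp 2 (w.fst, 0)))))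
    refine ⟨WithLp.toLp 2 (w.fst, q), WithLp.ofLp_injective 2 (Prod.ext rfl ?_)⟩
    change S.transSnd _ = w.snd
    have h3 := S.reflL_transSnd (WithLp.toLp 2 (w.fst, q))
    simp only [WithLp.toLp_fst, WithLp.toLp_snd] at h3
    rw [hq, add_sub_cancel_right] at h3
    rw [← reflL_reflL (S.transSnd _), h3, reflL_reflL]

/-- The transformation between the two state spaces as an isomorphism. -/
noncomputable def transEquiv : M₂ n ≃L[ℝ] M₂ n :=
  ContinuousLinearEquiv.ofBijective S.trans (LinearMap.ker_eq_bot.2 S.trans_bijective.1)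
    (LinearMap.range_eq_top.2 S.trans_bijective.2)

end System

/-! ### Representatives in `M₂` of functions of `H¹`, and norm estimates. -/

section Evaluation

variable {n : ℕ}

/-- The value at `c` of the correlation with a function of `L₂`, extended by zero. -/
noncomputable def corrAt (K : ℝ → E n →L[ℝ] E n) (hK : MemLp K 2 μ) (c : ℝ) :
    Lp (E n) 2 μ →L[ℝ] E n :=
  LinearMap.mkContinuous
    { toFun := fun f => corr K (ext0 f) c
      map_add' := fun f g => by
        rw [corr_congr (ext0_congr (Lp.coeFn_add f g)), ext0_add]
        exact corr_add hK (Lp.memLp_ext0 f) (Lp.memLp_ext0 g) _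
      map_smul' := fun c f => by
        rw [corr_congr (ext0_congr (Lp.coeFn_smul c f)), ext0_smul]
        exact corr_smul _ _ } (eLpNorm K 2 μ).toReal
    (fun f => by
      have h := enorm_corr_le' hK.1 (Lp.memLp_ext0 f).1 c
      have h2 := ENNReal.toReal_mono (ENNReal.mul_ne_top hK.2.ne (Lp.memLp_ext0 f).2.ne) h
      rwa [ENNReal.toReal_mul, toReal_enorm, eLpNorm_ext0] at h2)

theorem intervalIntegrable_of_memLp {F : Type*} [NormedAddCommGroup F] {f : ℝ → F}
    (hf : MemLp f 2 μ) {a b : ℝ} (ha : a ∈ Icc (-1 : ℝ) 0) (hb : b ∈ Icc (-1 : ℝ) 0) :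
    IntervalIntegrable f volume a b := by
  have h : IntervalIntegrable f volume (-1) 0 := by
    rw [intervalIntegrable_iff_integrableOn_Ioc_of_le (by norm_num)]
    exact hf.integrable (by norm_num)
  refine h.mono_set ?_
  rw [uIcc_of_le (by norm_num : (-1 : ℝ) ≤ 0)]
  exact uIcc_subset_Icc ha hb

theorem memLp_corr_sub {K : ℝ → E n →L[ℝ] E n} (hK : MemLp K 2 μ) {f : ℝ → E n}
    (hf : MemLp f 2 μ) (b : ℝ) : MemLp (fun θ => corr K (ext0 f) (b - θ)) 2 μ := by
  refine ((Lp.memLp (corrL K hK b hf.toLp)).ae_eq (coeFn_corrL hK b hf.toLp)).ae_eq ?_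
  exact Filter.Eventually.of_forall fun θ => corr_congr (ext0_congr hf.coeFn_toLp) _

theorem memLp_comp_refl {f : ℝ → E n} (hf : MemLp f 2 μ) : MemLp (fun θ => f (-1 - θ)) 2 μ :=
  hf.comp_measurePreserving measurePreserving_refl

/-- The element of `M₂` that represents a function of `H¹`. -/
noncomputable def IsH1On.rep {f f' : ℝ → E n} (hf : IsH1On (-1) 0 f f') : M₂ n :=
  WithLp.toLp 2 (f (-1), hf.memLp.toLp)

theorem IsH1On.rep_fst {f f' : ℝ → E n} (hf : IsH1On (-1) 0 f f') : hf.rep.fst = f (-1) := rfl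

theorem IsH1On.rep_snd {f f' : ℝ → E n} (hf : IsH1On (-1) 0 f f') : hf.rep.snd =ᵐ[μ] f' :=
  hf.memLp.coeFn_toLp

theorem IsH1On.prim_rep {f f' : ℝ → E n} (hf : IsH1On (-1) 0 f f') {θ : ℝ}
    (hθ : θ ∈ Icc (-1 : ℝ) 0) : prim hf.rep θ = f θ :=
  (hf.eq_prim hf.rep_fst hf.rep_snd hθ).symm

theorem norm_le_fst_add_snd (y : M₂ n) : ‖y‖ ≤ ‖y.fst‖ + ‖y.snd‖ := by
  rw [WithLp.prod_norm_eq_of_L2]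
  refine Real.sqrt_le_iff.2 ⟨by positivity, ?_⟩
  nlinarith [norm_nonneg y.fst, norm_nonneg y.snd]

/-- The constant φ(-1) is φ minus the primitive of φ' that vanishes at -1, and a constant has the
same norm in `L₂` as in ℝⁿ because `μ` has mass one. -/
theorem norm_fst_le_primL (y : M₂ n) : ‖y.fst‖ ≤ ‖primL y‖ + ‖(primL (n := n))‖ * ‖y.snd‖ := by
  have h0 : ‖primL (WithLp.toLp 2 (y.fst, (0 : Lp (E n) 2 μ)))‖ = ‖y.fst‖ := by
    have h1 : primL (WithLp.toLp 2 (y.fst, (0 : Lp (E n) 2 μ))) =ᵐ[μ] fun _ => y.fst := by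
      refine (coeFn_primL _).trans (Filter.Eventually.of_forall fun θ => ?_)
      have h2 : ∫ s in (-1)..θ, ext0 (0 : Lp (E n) 2 μ) s = 0 := by
        refine intervalIntegral.integral_zero_ae ?_
        filter_upwards [ext0_congr (Lp.coeFn_zero (E n) 2 μ)] with s hs _
        rw [hs]
        by_cases h : s ∈ Ioc (-1 : ℝ) 0
        · rw [ext0_of_mem h, Pi.zero_apply]
        · rw [ext0_of_notMem h]
      exact (congrArg (y.fst + ·) h2).trans (add_zero _)
    rw [Lp.norm_def, eLpNorm_congr_ae h1, eLpNorm_const _ (by norm_num) (NeZero.ne _)]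
    simp
  have h3 : primL (WithLp.toLp 2 (y.fst, (0 : Lp (E n) 2 μ))) = primL y - primL (inrL y.snd) := by
    rw [eq_sub_iff_add_eq, ← map_add, ← eq_add_inrL]
  rw [← h0, h3]
  refine (norm_sub_le _ _).trans ?_
  gcongr
  refine (primL.le_opNorm _).trans ?_
  gcongr
  exact (WithLp.norm_toLp_snd 2 (E n) (Lp (E n) 2 μ) y.snd).le

end Evaluation

/-! ### The domain of `𝒜` with its graph norm, and the intertwining with `𝒜~`. -/

namespace System

variable {n : ℕ} (S : System n)

theorem L_eq_corr (f f' : ℝ → E n) (hf : IsH1On (-1) 0 f f') :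
    S.L f f' = corr (kernel S.A₂) (ext0 f') 0 + corr (kernel S.A₃) (ext0 f) 0 := by
  rw [corr, corr, ← integral_add (integrable_corr (memLp_kernel S.memLp₂) (memLp_ext0 hf.memLp) 0)
    (integrable_corr (memLp_kernel S.memLp₃) (memLp_ext0 hf.memLp_self) 0), L,
    intervalIntegral.integral_of_le (by norm_num)]
  refine setIntegral_congr_fun measurableSet_Ioc fun s hs => ?_
  simp only [zero_add, ext0_of_mem hs, kernel_apply]

/-- The functional `L` on functions of `H¹`, represented by elements of `M₂`. -/
noncomputable def functional : M₂ n →L[ℝ] E n :=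
  corrAt (kernel S.A₂) (memLp_kernel S.memLp₂) 0 ∘L WithLp.sndL 2 ℝ (E n) (Lp (E n) 2 μ) +
    corrAt (kernel S.A₃) (memLp_kernel S.memLp₃) 0 ∘L primL

theorem functional_apply (y : M₂ n) : S.functional y =
    corr (kernel S.A₂) (ext0 y.snd) 0 + corr (kernel S.A₃) (ext0 (prim y)) 0 := by
  rw [← corr_congr (ext0_congr (coeFn_primL y))]
  rfl

theorem functional_eq_L (y : M₂ n) : S.functional y = S.L (prim y) y.snd := by
  rw [S.L_eq_corr _ _ (isH1On_prim y), functional_apply]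

/-- The state of the neutral type equation determined by a function of `H¹`. -/
noncomputable def stateL : M₂ n →L[ℝ] M₂ n :=
  (WithLp.prodContinuousLinearEquiv 2 ℝ (E n) (Lp (E n) 2 μ)).symm.toContinuousLinearMap ∘L
    (primAt 0 - Matrix.toEuclideanCLM (𝕜 := ℝ) S.A₁ ∘L primAt (-1)).prod primL

theorem stateL_fst (y : M₂ n) : (S.stateL y).fst = prim y 0 - app S.A₁ (prim y (-1)) := rfl

theorem stateL_snd (y : M₂ n) : (S.stateL y).snd = primL y := rfl

theorem isState_stateL (y : M₂ n) : S.IsState (S.stateL y) (prim y) y.snd :=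
  ⟨isH1On_prim y, coeFn_primL y, rfl⟩

theorem IsState.stateL_rep {S : System n} {ξ : M₂ n} {z z' : ℝ → E n} (h : S.IsState ξ z z') :
    S.stateL h.1.rep = ξ := by
  refine WithLp.ofLp_injective 2 (Prod.ext ?_ ?_)
  · change (S.stateL h.1.rep).fst = ξ.fst
    rw [stateL_fst, h.1.prim_rep (by norm_num), h.1.prim_rep (by norm_num), h.2.2]
  · change (S.stateL h.1.rep).snd = ξ.snd
    rw [stateL_snd]
    refine Lp.ext ((coeFn_primL _).trans (Filter.EventuallyEq.trans ?_ h.2.1.symm))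
    filter_upwards [ae_restrict_mem measurableSet_Ioc] with θ hθ
    exact h.1.prim_rep (Ioc_subset_Icc_self hθ)

theorem stateL_injective : Function.Injective S.stateL := by
  refine (injective_iff_map_eq_zero _).2 fun y hy => ?_
  have h0 : prim y =ᵐ[μ] 0 := by
    have h1 : primL y = 0 := (congrArg WithLp.snd hy : _)
    have h2 := coeFn_primL y
    rw [h1] at h2
    exact h2.symm.trans (Lp.coeFn_zero _ _ _)
  have h1 : y.fst = 0 := by
    rw [← prim_neg_one]
    exact (isH1On_prim y).eqOn_zero (by norm_num) h0 _ (by norm_num)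
  have h2 : y.snd = 0 :=
    Lp.ext (((isH1On_prim y).deriv_ae_zero (by norm_num) h0).trans (Lp.coeFn_zero _ _ _).symm)
  exact WithLp.ofLp_injective 2 (Prod.ext h1 h2)

theorem mem_graph_stateL (y : M₂ n) :
    (S.stateL y, WithLp.toLp 2 (S.functional y, y.snd)) ∈ S.opA.graph := by
  rw [opA_graph]
  exact ⟨prim y, y.snd, S.isState_stateL y, S.functional_eq_L y, Filter.EventuallyEq.rfl⟩

theorem stateL_mem_domain (y : M₂ n) : S.stateL y ∈ S.opA.domain :=
  LinearPMap.mem_domain_of_mem_graph (S.mem_graph_stateL y)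

theorem opA_stateL (y : M₂ n) : S.opA ⟨S.stateL y, S.stateL_mem_domain y⟩ =
    WithLp.toLp 2 (S.functional y, y.snd) := by
  obtain ⟨x, hx, h⟩ := (LinearPMap.mem_graph_iff _).1 (S.mem_graph_stateL y)
  refine Eq.trans ?_ h
  congr 1
  exact Subtype.ext hx.symm

theorem exists_isState (ξ : S.opA.domain) : ∃ z z', S.IsState (ξ : M₂ n) z z' := by
  have h := S.opA.mem_graph ξ
  rw [opA_graph] at h
  obtain ⟨z, z', h, -⟩ := h
  exact ⟨z, z', h⟩

/-- The domain of `𝒜` is parametrized by the functions of `H¹`. -/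
noncomputable def stateEquiv : M₂ n ≃ₗ[ℝ] S.opA.domain :=
  LinearEquiv.ofBijective (S.stateL.toLinearMap.codRestrict S.opA.domain S.stateL_mem_domain)
    ⟨fun y y' h => S.stateL_injective (congrArg Subtype.val h), fun ξ => by
      obtain ⟨z, z', h⟩ := S.exists_isState ξ
      exact ⟨h.1.rep, Subtype.ext h.stateL_rep⟩⟩

theorem coe_stateEquiv (y : M₂ n) : (S.stateEquiv y : M₂ n) = S.stateL y := rfl

theorem graphNorm_stateEquiv (y : M₂ n) : graphNorm S.opA (S.stateEquiv y) =
    √(‖S.stateL y‖ ^ 2 + ‖(WithLp.toLp 2 (S.functional y, y.snd) : M₂ n)‖ ^ 2) := by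
  rw [← S.opA_stateL]
  rfl

theorem exists_graphNorm_le : ∃ C, 0 ≤ C ∧
    ∀ y, graphNorm S.opA (S.stateEquiv y) ≤ C * ‖y‖ := by
  refine ⟨‖S.stateL‖ + (‖S.functional‖ + 1), by positivity, fun y => ?_⟩
  rw [graphNorm_stateEquiv]
  have h1 := S.stateL.le_opNorm y
  have h2 := S.functional.le_opNorm y
  have h3 := WithLp.norm_snd_le _ y
  have h4 := norm_le_fst_add_snd (WithLp.toLp 2 (S.functional y, y.snd) : M₂ n)
  simp only [WithLp.toLp_fst, WithLp.toLp_snd] at h4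
  have h5 : √(‖S.stateL y‖ ^ 2 + ‖(WithLp.toLp 2 (S.functional y, y.snd) : M₂ n)‖ ^ 2) ≤
      ‖S.stateL y‖ + ‖(WithLp.toLp 2 (S.functional y, y.snd) : M₂ n)‖ := by
    refine Real.sqrt_le_iff.2 ⟨by positivity, ?_⟩
    nlinarith [norm_nonneg (S.stateL y),
      norm_nonneg (WithLp.toLp 2 (S.functional y, y.snd) : M₂ n)]
  linarith

/-- The graph norm dominates φ, as the second component of the state, and φ', as the second
component of its image under `𝒜`; `norm_fst_le_primL` then bounds φ(-1). -/
theorem exists_le_graphNorm : ∃ C, 0 ≤ C ∧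
    ∀ y, ‖y‖ ≤ C * graphNorm S.opA (S.stateEquiv y) := by
  refine ⟨1 + ‖(primL (n := n))‖ + 1, by positivity, fun y => ?_⟩
  rw [graphNorm_stateEquiv]
  set w : M₂ n := WithLp.toLp 2 (S.functional y, y.snd)
  have h1 := norm_fst_le_primL y
  have h2 : ‖primL y‖ ≤ √(‖S.stateL y‖ ^ 2 + ‖w‖ ^ 2) :=
    (WithLp.norm_snd_le _ (S.stateL y)).trans
      (Real.le_sqrt_of_sq_le (by nlinarith [norm_nonneg w]))
  have h3 : ‖y.snd‖ ≤ √(‖S.stateL y‖ ^ 2 + ‖w‖ ^ 2) :=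
    (WithLp.norm_snd_le _ w).trans
      (Real.le_sqrt_of_sq_le (by nlinarith [norm_nonneg (S.stateL y)]))
  have h4 := norm_le_fst_add_snd y
  have h5 := mul_le_mul_of_nonneg_left h3 (norm_nonneg (primL (n := n)))
  linarith

/-- The transformation maps a function of `H¹` that satisfies the boundary condition into the
domain of `𝒜~`, and intertwines the derivative with `𝒜~`. -/
theorem trans_mem_graphAt {f f' : ℝ → E n} (hf : IsH1On (-1) 0 f f') {y y' : M₂ n}
    (hy : y.snd =ᵐ[μ] f) (h1 : y'.fst = f (-1)) (h2 : y'.snd =ᵐ[μ] f')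
    (hb : f 0 - app S.A₁ (f (-1)) = S.functional y) :
    (S.trans y, S.trans y') ∈ S.graphAt := by
  have hK2 := memLp_kernel S.memLp₂
  have hK3 := memLp_kernel S.memLp₃
  have hprim : ∀ θ, ext0 (prim y') θ = ext0 f θ := fun θ => by
    by_cases h : θ ∈ Ioc (-1 : ℝ) 0
    · rw [ext0_of_mem h, ext0_of_mem h, hf.eq_prim h1 h2 (Ioc_subset_Icc_self h)]
    · rw [ext0_of_notMem h, ext0_of_notMem h]
  have hyf : IsH1On (-1) 0 (prim y) f := by
    refine ⟨hf.memLp_self, fun θ hθ => ?_⟩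
    rw [(isH1On_prim y).mem_ext0 hθ, ← integral_ext0 f le_rfl hθ.1 hθ.2]
    congr 1
    exact intervalIntegral.integral_congr_ae ((ext0_congr hy).mono fun s hs _ => hs)
  have hy'2 : ∀ c, corr (kernel S.A₂) (ext0 y'.snd) c = corr (kernel S.A₂) (ext0 f') c :=
    corr_congr (ext0_congr h2)
  have hy2 : ∀ c, corr (kernel S.A₂) (ext0 y.snd) c = corr (kernel S.A₂) (ext0 f) c :=
    corr_congr (ext0_congr hy)
  -- This is ψ + A₂w for (w, ψ) = `trans y`: the rough term A₂(θ)φ(-1) cancels. The derivative `r'`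
  -- is dictated by the second component of `𝒜~`; what has to be shown is that it is the derivative
  -- of `r`.
  set r : ℝ → E n := fun θ => f (-1 - θ) - corr (kernel S.A₂) (ext0 f) (-1 - θ)
    - corr (kernel S.A₃) (ext0 (prim y)) (-1 - θ) with hr
  set r' : ℝ → E n := fun θ => -S.transSnd y' θ + app (S.A₃ θ) y.fst with hr'
  have hr'm : MemLp r' 2 μ :=
    (Lp.memLp (S.transSnd y')).neg.add (memLp_apply_const hK3 y.fst)
  -- The base point is 0, where both correlations vanish. The jump term of the `A₃` correlation,
  -- A₃(θ)φ(-1), is the A₃w of `𝒜~`.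
  have hrint : ∀ θ ∈ Icc (-1 : ℝ) 0, r θ = f (-1) - ∫ σ in θ..0, r' σ := by
    intro θ hθ
    have e0 : f (-1 - θ) = f (-1) + ∫ σ in θ..0, f' (-1 - σ) := by
      rw [hf.eq_primitive (-1 - θ) ⟨by linarith [hθ.2], by linarith [hθ.1]⟩,
        intervalIntegral.integral_comp_sub_left, sub_zero]
    have i0 := intervalIntegrable_of_memLp (memLp_comp_refl hf.memLp) hθ
      (show (0 : ℝ) ∈ Icc (-1 : ℝ) 0 by norm_num)
    have i1 := intervalIntegrable_of_memLp
      ((memLp_apply_const hK2 (f (-1))).add (memLp_corr_sub hK2 hf.memLp (-1))) hθ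
      (show (0 : ℝ) ∈ Icc (-1 : ℝ) 0 by norm_num)
    have i2 := intervalIntegrable_of_memLp
      ((memLp_apply_const hK3 (prim y (-1))).add (memLp_corr_sub hK3 hyf.memLp (-1))) hθ
      (show (0 : ℝ) ∈ Icc (-1 : ℝ) 0 by norm_num)
    simp only [hr]
    rw [e0, corr_ext0_eq_integral hK2 hf hθ, corr_ext0_eq_integral hK3 hyf hθ, add_sub_assoc,
      add_sub_assoc, sub_eq_add_neg _ (∫ σ in θ..0, r' σ), ← intervalIntegral.integral_neg]
    congr 1
    have e1 := intervalIntegral.integral_sub i0 i1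
    have e2 := intervalIntegral.integral_sub (i0.sub i1) i2
    refine (congrArg (· - _) e1.symm).trans (e2.symm.trans ?_)
    refine intervalIntegral.integral_congr_ae ?_
    have hsub : Ioc θ 0 ⊆ Ioc (-1 : ℝ) 0 := Ioc_subset_Ioc_left hθ.1
    rw [uIoc_of_le hθ.2, ← ae_restrict_iff' measurableSet_Ioc]
    refine ae_restrict_of_ae_restrict_of_subset hsub ?_
    filter_upwards [S.coeFn_transSnd y',
      measurePreserving_refl.quasiMeasurePreserving.ae_eq_comp h2] with σ hσ hσ2
    simp only [Function.comp_apply] at hσ2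
    simp only [hr', hσ, hσ2, hy'2, funext hprim, h1, kernel_apply, prim_neg_one, Pi.add_apply]
    abel
  have hr0 : r 0 = f (-1) := by
    rw [hrint 0 (by norm_num), intervalIntegral.integral_same, sub_zero]
  -- At θ = -1 the correlations are taken at 0, where together they form the functional `L`; hence
  -- `hb` becomes the boundary condition A₁r(0) = r(-1).
  have hr1 : r (-1) = f 0 - S.functional y := by
    rw [functional_apply, hy2]
    simp only [hr, sub_self, sub_sub]
  refine ⟨r, r', ⟨hr'm, fun θ hθ => ?_⟩, ?_, ?_, ?_, ?_⟩
  · rw [hrint θ hθ, hrint (-1) (by norm_num),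
      ← intervalIntegral.integral_add_adjacent_intervals (a := -1) (b := θ) (c := 0)
        (intervalIntegrable_of_memLp hr'm (by norm_num) hθ)
        (intervalIntegrable_of_memLp hr'm hθ (by norm_num))]
    abel
  · filter_upwards [S.coeFn_transSnd y,
      measurePreserving_refl.quasiMeasurePreserving.ae_eq_comp hy] with θ hθ hθ2
    simp only [Function.comp_apply] at hθ2
    simp only [trans_fst, trans_snd, hθ, hθ2, hy2, hr]
    abel
  · rw [hr0, hr1, ← hb]
    abel
  · rw [hr0, trans_fst, h1]
  · exact Filter.Eventually.of_forall fun θ => by simp [hr']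

end System

/-! ### An integrated transport equation. -/

section Transport

/-- An integrated form of the transport equation `∂P/∂t + ∂P/∂a = 0` with zero outflow. -/
theorem integral_eq_zero_of_transport {F : Type*} [NormedAddCommGroup F] [NormedSpace ℝ F]
    [CompleteSpace F] {P : ℝ → ℝ → F} (hP : Continuous (Function.uncurry P))
    (h : ∀ t ∈ Icc (0 : ℝ) 1, ∀ a ∈ Icc (-1 : ℝ) 0,
      ∫ b in a..0, (P t b - P 0 b) = ∫ τ in (0 : ℝ)..t, P τ a) {a : ℝ} (ha : a ∈ Icc (-1 : ℝ) 0) :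
    ∫ b in a..0, P 0 b = 0 := by
  have hP2 : ∀ t, Continuous (P t) := fun t => hP.comp (by fun_prop : Continuous fun b => (t, b))
  have hP1 : ∀ b, Continuous fun t => P t b := fun b =>
    hP.comp (by fun_prop : Continuous fun t => (t, b))
  have hI : ∀ t a b, IntervalIntegrable (P t) volume a b := fun t a b =>
    (hP2 t).intervalIntegrable a b
  have hI1 : ∀ b s t, IntervalIntegrable (fun τ => P τ b) volume s t := fun b s t =>
    (hP1 b).intervalIntegrable s t
  -- The mass to the right of the characteristic that starts at `a`. It is shown to be constant,
  -- although `P` need not be differentiable.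
  set g : ℝ → F := fun τ => ∫ b in (τ + a)..0, P τ b with hg
  have hgc : Continuous g := by
    have h1 : Continuous fun τ => ∫ b in (0 : ℝ)..(τ + a), P τ b :=
      intervalIntegral.continuous_parametric_intervalIntegral_of_continuous
        (f := P) hP (by fun_prop)
    refine h1.neg.congr fun τ => ?_
    rw [hg]
    exact (intervalIntegral.integral_symm _ _).symm
  -- The hypothesis at times τ+η and τ, both at the point τ+η+a, gives the inflow across that point;
  -- from it the mass between τ+a and τ+η+a is subtracted.
  have hstep : ∀ τ η, 0 ≤ τ → 0 ≤ η → τ + η ≤ -a → g (τ + η) - g τ =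
      ∫ s in (0 : ℝ)..η, (P (τ + s) (τ + η + a) - P τ (τ + a + s)) := by
    intro τ η hτ hη hle
    have ha1 := ha.1
    have m1 : τ + η + a ∈ Icc (-1 : ℝ) 0 := ⟨by linarith, by linarith⟩
    have e1 := h (τ + η) ⟨by linarith, by linarith⟩ _ m1
    have e2 := h τ ⟨by linarith, by linarith⟩ _ m1
    rw [intervalIntegral.integral_sub (hI _ _ _) (hI _ _ _)] at e1 e2
    have e3 := intervalIntegral.integral_add_adjacent_intervals
      (hI1 (τ + η + a) 0 τ) (hI1 (τ + η + a) τ (τ + η))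
    have e4 := intervalIntegral.integral_add_adjacent_intervals
      (hI τ (τ + a) (τ + η + a)) (hI τ (τ + η + a) 0)
    have e5 : ∫ s in (0 : ℝ)..η, P (τ + s) (τ + η + a) = ∫ s in τ..(τ + η), P s (τ + η + a) := by
      rw [intervalIntegral.integral_comp_add_left (fun s => P s (τ + η + a)) τ, add_zero]
    have e6 : ∫ s in (0 : ℝ)..η, P τ (τ + a + s) = ∫ s in (τ + a)..(τ + η + a), P τ s := by
      rw [intervalIntegral.integral_comp_add_left (fun s => P τ s) (τ + a), add_zero]
      congr 1
      ring
    rw [intervalIntegral.integral_sub (by apply Continuous.intervalIntegrable; fun_prop)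
      (by apply Continuous.intervalIntegrable; fun_prop), e5, e6]
    simp only [hg]
    rw [← e4, sub_eq_iff_eq_add.1 e1, ← e3, ← e2]
    abel
  -- Both values of `P` in the increment are taken within δ of (τ, τ+a), so the increment is o(η)
  -- and the right derivative of `g` vanishes.
  have hzero := constant_of_has_deriv_right_zero (f := g) (a := 0) (b := -a) hgc.continuousOn
    (fun τ hτ => by
      rw [hasDerivWithinAt_iff_isLittleO, Asymptotics.isLittleO_iff]
      intro ε hε
      obtain ⟨δ, hδ, hδ2⟩ := Metric.continuous_iff.1 hP (τ, τ + a) (ε / 2) (by positivity)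
      have hmem : Iio (τ + min δ (-a - τ)) ∈ nhds τ :=
        Iio_mem_nhds (by have := hτ.2; have : 0 < min δ (-a - τ) := lt_min hδ (by linarith)
                         linarith)
      filter_upwards [mem_nhdsWithin_of_mem_nhds hmem, self_mem_nhdsWithin] with x hx1 hx2
      have hx1' : x < τ + min δ (-a - τ) := hx1
      have hx2' : τ ≤ x := hx2
      have m1 := min_le_left δ (-a - τ)
      have m2 := min_le_right δ (-a - τ)
      have e := hstep τ (x - τ) hτ.1 (by linarith) (by linarith)
      rw [add_sub_cancel] at e
      rw [smul_zero, sub_zero, e]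
      have hb := intervalIntegral.norm_integral_le_of_norm_le_const (a := 0) (b := x - τ) (C := ε)
        (f := fun s => P (τ + s) (x + a) - P τ (τ + a + s)) (fun s hs => by
          rw [uIoc_of_le (by linarith)] at hs
          have d1 := hδ2 (τ + s, x + a) (by
            rw [Prod.dist_eq, max_lt_iff, Real.dist_eq, Real.dist_eq, abs_lt, abs_lt]
            refine ⟨⟨?_, ?_⟩, ⟨?_, ?_⟩⟩ <;> dsimp only <;> linarith [hs.1, hs.2])
          have d2 := hδ2 (τ, τ + a + s) (by
            rw [Prod.dist_eq, max_lt_iff, Real.dist_eq, Real.dist_eq, abs_lt, abs_lt]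
            refine ⟨⟨?_, ?_⟩, ⟨?_, ?_⟩⟩ <;> dsimp only <;> linarith [hs.1, hs.2])
          rw [← dist_eq_norm]
          have d3 := dist_triangle_right (P (τ + s) (x + a)) (P τ (τ + a + s)) (P τ (τ + a))
          simp only [Function.uncurry_apply_pair] at d1 d2
          linarith)
      rwa [sub_zero, ← Real.norm_eq_abs] at hb)
  -- At τ = -a the characteristic has reached 0 and the domain of integration is empty.
  have h1 := hzero (-a) ⟨by linarith [ha.2], le_rfl⟩
  simp only [hg, neg_add_cancel, zero_add, intervalIntegral.integral_same] at h1
  exact h1.symm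

end Transport

/-! ### Uniqueness of the initial datum of `𝒜~` for a given first component. -/

section Uniqueness

variable {n : ℕ}

theorem continuous_uncurry_prim : Continuous fun p : M₂ n × ℝ => prim p.1 p.2 := by
  refine continuous_prod_of_continuous_lipschitzWith _ 2 (fun y => continuous_prim y) fun θ => ?_
  refine LipschitzWith.of_dist_le_mul fun y y' => ?_
  have h := norm_prim_le (y - y') θ
  rw [← primAt_apply, map_sub] at h
  rw [dist_eq_norm, dist_eq_norm]
  exact h

theorem prim_zero_sub (y : M₂ n) {a : ℝ} (ha : a ∈ Icc (-1 : ℝ) 0) :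
    prim y 0 - prim y a = ∫ s in a..0, y.snd s := by
  rw [← integral_ext0 _ ha.1 ha.2 le_rfl, prim, prim, add_sub_add_left_eq_sub,
    intervalIntegral.integral_interval_sub_left (intervalIntegrable_ext0 (Lp.memLp _) _ _)
      (intervalIntegrable_ext0 (Lp.memLp _) _ _)]

theorem integral_congr_of_ae {f g : ℝ → E n} (h : f =ᵐ[μ] g) {a : ℝ} (ha : a ∈ Icc (-1 : ℝ) 0) :
    ∫ s in a..0, f s = ∫ s in a..0, g s := by
  refine intervalIntegral.integral_congr_ae ?_
  rw [uIoc_of_le ha.2, ← ae_restrict_iff' measurableSet_Ioc]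
  exact ae_restrict_of_ae_restrict_of_subset (Ioc_subset_Ioc_left ha.1) h

/-- The two relations between the tails of a mild solution of `𝒜~` with vanishing first
component. -/
theorem System.integral_tail_of_mem_graphAt {S : System n} {p : M₂ n × M₂ n} (hp : p ∈ S.graphAt)
    (h1 : p.1.fst = 0) (h2 : p.2.fst = 0) {a : ℝ} (ha : a ∈ Icc (-1 : ℝ) 0) :
    ∫ b in a..0, (prim p.2 0 - prim p.2 b) = prim p.1 0 - prim p.1 a := by
  obtain ⟨r, r', hr, e1, -, e3, e4⟩ := hp
  simp only [h1, map_zero, add_zero] at e1 e4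
  rw [prim_zero_sub _ ha, integral_congr_of_ae e1 ha]
  refine intervalIntegral.integral_congr fun b hb => ?_
  rw [uIcc_of_le ha.2] at hb
  have hb' : b ∈ Icc (-1 : ℝ) 0 := ⟨ha.1.trans hb.1, hb.2⟩
  rw [prim_zero_sub _ hb', integral_congr_of_ae e4 hb', intervalIntegral.integral_neg,
    hr.eq_primitive b hb']
  have h0 := hr.eq_primitive 0 (by norm_num)
  rw [← e3, h2] at h0
  rw [← intervalIntegral.integral_add_adjacent_intervals
    (hr.intervalIntegrable hb')
    (intervalIntegrable_of_memLp hr.memLp hb' (by norm_num))] at h0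
  rw [← add_assoc] at h0
  exact (eq_neg_of_add_eq_zero_left h0.symm).symm

theorem eq_zero_of_prim_tail {y : M₂ n} (h1 : y.fst = 0)
    (h : ∀ a ∈ Icc (-1 : ℝ) 0, prim y 0 - prim y a = 0) : y = 0 := by
  have h2 : ∀ a ∈ Icc (-1 : ℝ) 0, prim y a = 0 := fun a ha => by
    have e1 := h a ha
    have e2 := h (-1) (by norm_num)
    rw [prim_neg_one, h1, sub_zero] at e2
    rwa [e2, zero_sub, neg_eq_zero] at e1
  refine WithLp.ofLp_injective 2 (Prod.ext h1 (Lp.ext ?_))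
  refine ((isH1On_prim y).deriv_ae_zero (by norm_num) ?_).trans (Lp.coeFn_zero _ _ _).symm
  filter_upwards [ae_restrict_mem measurableSet_Ioc] with θ hθ
  exact h2 θ (Ioc_subset_Icc_self hθ)

theorem IsMildSolution.mem_graph {H : Type*} [NormedAddCommGroup H] [NormedSpace ℝ H]
    {T : H →ₗ.[ℝ] H} {x₀ : H} {x : ℝ → H} (hx : IsMildSolution T x₀ x) {t : ℝ} (ht : 0 ≤ t) :
    (∫ s in (0 : ℝ)..t, x s, x t - x₀) ∈ T.graph := by
  obtain ⟨h, e⟩ := hx.eqn t ht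
  rw [e, add_sub_cancel_left]
  exact T.mem_graph ⟨_, h⟩

theorem isMildSolution_of_mem_graph {H : Type*} [NormedAddCommGroup H] [NormedSpace ℝ H]
    {T : H →ₗ.[ℝ] H} {x₀ : H} {x : ℝ → H} (hc : ContinuousOn x (Ici 0)) (h0 : x 0 = x₀)
    (h : ∀ t, 0 ≤ t → (∫ s in (0 : ℝ)..t, x s, x t - x₀) ∈ T.graph) : IsMildSolution T x₀ x := by
  refine ⟨hc, h0, fun t ht => ?_⟩
  obtain ⟨y, hy1, hy2⟩ := (LinearPMap.mem_graph_iff _).1 (h t ht)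
  dsimp only at hy1 hy2
  refine ⟨hy1 ▸ y.2, ?_⟩
  have : (⟨∫ s in (0 : ℝ)..t, x s, hy1 ▸ y.2⟩ : T.domain) = y := Subtype.ext hy1.symm
  rw [this, hy2, add_sub_cancel]

/-- A mild solution of `𝒜~` is determined by its first component on `[0, 1]`. -/
theorem System.initial_eq_of_fst_eq {S : System n} {x₀ y₀ : M₂ n} {x y : ℝ → M₂ n}
    (hx : IsMildSolution S.opAt x₀ x) (hy : IsMildSolution S.opAt y₀ y)
    (h : ∀ t ∈ Icc (0 : ℝ) 1, (x t).fst = (y t).fst) : x₀ = y₀ := by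
  -- Freezing the time at 0 for negative arguments makes the difference continuous on all of ℝ.
  set d : ℝ → M₂ n := fun t => x (max t 0) - y (max t 0) with hd
  have hm : Continuous fun t : ℝ => max t 0 := by fun_prop
  have hdc : Continuous d :=
    (hx.continuousOn.comp_continuous hm fun t => le_max_right t 0).sub
      (hy.continuousOn.comp_continuous hm fun t => le_max_right t 0)
  have hd0 : d 0 = x₀ - y₀ := by simp [hd, hx.init, hy.init]
  have hfst : ∀ t ∈ Icc (0 : ℝ) 1, (d t).fst = 0 := fun t ht => by
    simp only [hd, max_eq_left ht.1, WithLp.sub_fst, h t ht, sub_self]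
  have hgraph : ∀ t, 0 ≤ t → (∫ s in (0 : ℝ)..t, d s, d t - d 0) ∈ S.graphAt := fun t ht => by
    have h1 := S.opAt.graph.sub_mem (hx.mem_graph ht) (hy.mem_graph ht)
    rw [S.opAt_graph] at h1
    convert h1 using 1
    refine Prod.ext ?_ ?_
    · have hi : ∀ {w₀ : M₂ n} {w : ℝ → M₂ n}, IsMildSolution S.opAt w₀ w →
          IntervalIntegrable w volume 0 t := fun hw =>
        (hw.continuousOn.mono (by
          rw [uIcc_of_le ht]
          exact Icc_subset_Ici_self)).intervalIntegrable
      rw [Prod.fst_sub, ← intervalIntegral.integral_sub (hi hx) (hi hy)]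
      refine intervalIntegral.integral_congr fun s hs => ?_
      rw [uIcc_of_le ht] at hs
      simp only [max_eq_left hs.1]
    · simp only [hd0, Prod.snd_sub]
      simp only [hd, max_eq_left ht]
      abel
  have htail : ∀ a ∈ Icc (-1 : ℝ) 0, ∫ b in a..0, (prim (d 0) 0 - prim (d 0) b) = 0 := by
    intro a ha
    -- The transported quantity is the tail ∫_b^0 ψ_t, which is continuous in (t, b), whereas ψ_t is
    -- only an `L₂` class.
    refine integral_eq_zero_of_transport (P := fun t b => prim (d t) 0 - prim (d t) b) ?_ ?_ ha
    · exact (continuous_uncurry_prim.comp (by fun_prop : Continuous fun p : ℝ × ℝ =>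
        (d p.1, (0 : ℝ)))).sub (continuous_uncurry_prim.comp
          (by fun_prop : Continuous fun p : ℝ × ℝ => (d p.1, p.2)))
    · intro t ht a ha
      have hfst1 : (∫ s in (0 : ℝ)..t, d s).fst = 0 := by
        have e := ContinuousLinearMap.intervalIntegral_comp_comm
          (WithLp.fstL 2 ℝ (E n) (Lp (E n) 2 μ)) (hdc.intervalIntegrable (μ := volume) 0 t)
        refine e.symm.trans ?_
        refine (intervalIntegral.integral_congr (g := fun _ => 0) fun s hs => ?_).trans (by simp)
        rw [uIcc_of_le ht.1] at hs
        exact hfst s ⟨hs.1, hs.2.trans ht.2⟩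
      have h2 : (d t - d 0).fst = 0 := by
        rw [WithLp.sub_fst, hfst t ht, hfst 0 (by norm_num), sub_self]
      have e := integral_tail_of_mem_graphAt (hgraph t ht.1) hfst1 h2 ha
      dsimp only at e
      have e2 := ContinuousLinearMap.intervalIntegral_comp_comm
        (primAt (n := n) 0 - primAt a) (hdc.intervalIntegrable (μ := volume) 0 t)
      refine Eq.trans ?_ (e.trans e2.symm)
      refine intervalIntegral.integral_congr fun b _ => ?_
      simp only [← primAt_apply, map_sub]
      abel
  have hzero : d 0 = 0 := by
    have h0 := hfst 0 (by norm_num)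
    have hc : Continuous fun b => prim (d 0) 0 - prim (d 0) b :=
      continuous_const.sub (continuous_prim _)
    refine eq_zero_of_prim_tail h0 ?_
    -- By `htail` the zero function is a primitive of the tail at time 0, so the tail vanishes
    -- almost everywhere, and everywhere by continuity.
    have hH : IsH1On (-1) 0 (fun _ => (0 : E n)) fun b => prim (d 0) 0 - prim (d 0) b := by
      refine ⟨((memLp_const _).sub (memLp_prim _)), fun θ hθ => ?_⟩
      have e := intervalIntegral.integral_add_adjacent_intervals
        (hc.intervalIntegrable (μ := volume) (-1) θ) (hc.intervalIntegrable θ 0)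
      rw [htail θ hθ, htail (-1) (by norm_num), add_zero] at e
      rw [e, add_zero]
    have h3 := hH.deriv_ae_zero (by norm_num) Filter.EventuallyEq.rfl
    rw [restrict_Ioc_eq_restrict_Icc] at h3
    exact Measure.eqOn_Icc_of_ae_eq volume (by norm_num) h3 hc.continuousOn continuousOn_const
  exact sub_eq_zero.1 (hd0.symm.trans hzero)

end Uniqueness

/-! ### Trajectories t ↦ z(t+·) as continuous curves in `M₂`. -/

section Trajectory

variable {n : ℕ}

/-- On every half-line `(-∞, T]`, the function `u` agrees with a function of `L₂(ℝ)`. -/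
def IsPastL2 (u : ℝ → E n) : Prop :=
  ∀ T : ℝ, ∃ v : ℝ → E n, MemLp v 2 volume ∧ ∀ t ≤ T, u t = v t

variable {u z : ℝ → E n}

theorem IsPastL2.intervalIntegrable (hu : IsPastL2 u) (a b : ℝ) :
    IntervalIntegrable u volume a b := by
  obtain ⟨v, hv, h⟩ := hu (max a b)
  have h1 : IntervalIntegrable v volume a b :=
    (intervalIntegrable_iff' (by finiteness)).2
      ((hv.locallyIntegrable (by norm_num)).integrableOn_isCompact isCompact_uIcc)
  refine h1.congr fun t ht => (h t ?_).symm
  exact (mem_uIoc.1 ht).elim (fun h => h.2.trans (le_max_right _ _))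
    (fun h => h.2.trans (le_max_left _ _))

theorem IsPastL2.memLp_restrict (hu : IsPastL2 u) (a b : ℝ) :
    MemLp u 2 (volume.restrict (Ioc a b)) := by
  obtain ⟨v, hv, h⟩ := hu b
  refine (hv.restrict _).ae_eq ?_
  filter_upwards [ae_restrict_mem measurableSet_Ioc] with t ht
  exact (h t ht.2).symm

theorem IsPastL2.comp_add_left (hu : IsPastL2 u) (t : ℝ) : IsPastL2 fun θ => u (t + θ) := by
  intro T
  obtain ⟨v, hv, h⟩ := hu (t + T)
  exact ⟨_, memLp_comp_add_left hv t, fun s hs => h _ (by linarith)⟩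

theorem isH1On_shift (hu : IsPastL2 u) (hz : ∀ t, z t = z (-1) + ∫ s in (-1)..t, u s) (t : ℝ) :
    IsH1On (-1) 0 (fun θ => z (t + θ)) fun θ => u (t + θ) := by
  refine ⟨(hu.comp_add_left t).memLp_restrict _ _, fun θ _ => ?_⟩
  rw [intervalIntegral.integral_comp_add_left u t, hz (t + θ), hz (t + -1), add_assoc,
    intervalIntegral.integral_add_adjacent_intervals (hu.intervalIntegrable _ _)
      (hu.intervalIntegrable _ _)]

/-- Translation is continuous on `L₂(ℝ)`, and for times below t+1 the shifted segment only sees `u`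
below t+1, where it agrees with an `L₂` function. -/
theorem continuous_toLp_shift (hu : IsPastL2 u) :
    Continuous fun t : ℝ => (((hu.comp_add_left t).memLp_restrict (-1) 0).toLp : Lp (E n) 2 μ) := by
  refine continuous_iff_continuousAt.2 fun t => ?_
  obtain ⟨v, hv, h⟩ := hu (t + 1)
  have hc : Continuous fun s : ℝ => LpToLpRestrictCLM ℝ (E n) ℝ volume 2 (Ioc (-1 : ℝ) 0)
      (DomAddAct.mk s +ᵥ hv.toLp) := by
    have : Fact ((2 : ENNReal) ≠ ⊤) := ⟨by norm_num⟩
    have h1 : Continuous fun s : ℝ => DomAddAct.mk s := DomAddAct.continuous_mk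
    exact (ContinuousLinearMap.continuous _).comp (h1.vadd continuous_const)
  refine hc.continuousAt.congr ?_
  filter_upwards [Iio_mem_nhds (show t < t + 1 by linarith)] with s hs
  refine Lp.ext ((LpToLpRestrictCLM_coeFn ℝ _ _).trans
    (Filter.EventuallyEq.trans ?_ (MemLp.coeFn_toLp _).symm))
  have h2 := ae_restrict_of_ae (s := Ioc (-1 : ℝ) 0)
    (MemLp.coeFn_toLp (memLp_comp_add_left hv s))
  filter_upwards [h2, ae_restrict_mem measurableSet_Ioc] with θ hθ hmem
  refine Eq.trans ?_ (h (s + θ) (by have : s < t + 1 := hs; linarith [hmem.2])).symm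
  exact hθ

theorem continuous_of_primitive (hu : IsPastL2 u)
    (hz : ∀ t, z t = z (-1) + ∫ s in (-1)..t, u s) : Continuous z := by
  have h := intervalIntegral.continuous_primitive (fun a b => hu.intervalIntegrable a b) (-1)
  exact (continuous_const.add h).congr fun t => (hz t).symm

theorem continuous_rep_shift (hu : IsPastL2 u)
    (hz : ∀ t, z t = z (-1) + ∫ s in (-1)..t, u s) :
    Continuous fun t => (isH1On_shift hu hz t).rep := by
  refine (WithLp.prod_continuous_toLp 2 _ _).comp (Continuous.prodMk ?_ ?_)
  · exact (continuous_of_primitive hu hz).comp (by fun_prop : Continuous fun t : ℝ => t + -1)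
  · exact continuous_toLp_shift hu

theorem IsH1On.deriv_ae_unique {f f' g' : ℝ → E n} (hf : IsH1On (-1) 0 f f')
    (hg : IsH1On (-1) 0 f g') : f' =ᵐ[μ] g' := by
  have h := (hf.add (hg.smul (-1))).deriv_ae_zero (by norm_num)
    (Filter.Eventually.of_forall fun θ => by simp)
  filter_upwards [h] with θ hθ
  simpa [add_neg_eq_zero] using hθ

/-- The integral of the trajectory `t ↦ z(t + ·)` in `M₂`. -/
theorem integral_rep_shift_snd (hu : IsPastL2 u)
    (hz : ∀ t, z t = z (-1) + ∫ s in (-1)..t, u s) (t : ℝ) :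
    (∫ s in (0 : ℝ)..t, (isH1On_shift hu hz s).rep).snd =ᵐ[μ] fun θ => z (t + θ) - z θ := by
  have hzc := continuous_of_primitive hu hz
  set w := ∫ s in (0 : ℝ)..t, (isH1On_shift hu hz s).rep with hw
  -- Evaluation at a point is a bounded functional of the encoding, so it commutes with the integral
  -- in `M₂`.
  have hprim : ∀ a ∈ Icc (-1 : ℝ) 0, prim w a = ∫ s in a..(t + a), z s := by
    intro a ha
    have e := ContinuousLinearMap.intervalIntegral_comp_comm (primAt (n := n) a)
      ((continuous_rep_shift hu hz).intervalIntegrable (μ := volume) 0 t)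
    refine e.symm.trans ?_
    have e2 := intervalIntegral.integral_comp_add_right (a := 0) (b := t) z a
    rw [zero_add] at e2
    rw [← e2]
    exact intervalIntegral.integral_congr fun s _ => (isH1On_shift hu hz s).prim_rep ha
  have hi : ∀ a b, IntervalIntegrable z volume a b := fun a b => hzc.intervalIntegrable a b
  have hH : IsH1On (-1) 0 (prim w) fun θ => z (t + θ) - z θ := by
    have hc : Continuous fun θ => z (t + θ) - z θ := by fun_prop
    refine ⟨?_, fun a ha => ?_⟩
    · obtain ⟨C, hC⟩ := (isCompact_Icc (a := (-1 : ℝ)) (b := 0)).exists_bound_of_continuousOn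
        hc.continuousOn
      refine MemLp.of_bound hc.aestronglyMeasurable C ?_
      filter_upwards [ae_restrict_mem measurableSet_Ioc] with θ hθ
      exact hC θ (Ioc_subset_Icc_self hθ)
    · rw [hprim a ha, hprim (-1) (by norm_num), intervalIntegral.integral_sub
        (by apply Continuous.intervalIntegrable; fun_prop) (hi _ _),
        intervalIntegral.integral_comp_add_left z t,
        ← intervalIntegral.integral_add_adjacent_intervals (hi a (-1)) (hi (-1) (t + a)),
        ← intervalIntegral.integral_add_adjacent_intervals (hi (-1) (t + -1)) (hi (t + -1) (t + a)),
        intervalIntegral.integral_symm (-1) a]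
      abel
  exact (isH1On_prim w).deriv_ae_unique hH

end Trajectory

/-! ### From solutions of the neutral equation to mild solutions. -/

namespace System

variable {n : ℕ} (S : System n)

theorem functional_rep {f f' : ℝ → E n} (hf : IsH1On (-1) 0 f f') :
    S.functional hf.rep = S.L f f' := by
  rw [functional_apply, S.L_eq_corr f f' hf, corr_congr (ext0_congr hf.rep_snd)]
  congr 1
  refine corr_congr (ext0_congr ?_) 0
  filter_upwards [ae_restrict_mem measurableSet_Ioc] with θ hθ
  exact hf.prim_rep (Ioc_subset_Icc_self hθ)

/-- The transformation maps the trajectory of a solution of the neutral type equation to a mild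
solution of the transposed-form system. -/
theorem isMildSolution_trans_rep {u z : ℝ → E n} (hu : IsPastL2 u)
    (hz : ∀ t, z t = z (-1) + ∫ s in (-1)..t, u s)
    (heq : ∀ᵐ t ∂(volume.restrict (Ioi (0 : ℝ))),
      u t = app S.A₁ (u (t - 1)) + S.L (fun θ => z (t + θ)) (fun θ => u (t + θ))) :
    IsMildSolution S.opAt (S.trans (isH1On_shift hu hz 0).rep)
      fun t => S.trans (isH1On_shift hu hz t).rep := by
  have hYc := continuous_rep_shift hu hz
  refine isMildSolution_of_mem_graph (S.trans.continuous.comp hYc).continuousOn rfl fun t ht => ?_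
  rw [opAt_graph, ContinuousLinearMap.intervalIntegral_comp_comm _
    (hYc.intervalIntegrable (μ := volume) 0 t), ← map_sub]
  have h0 : IsH1On (-1) 0 (fun θ => z (t + θ) - z θ) fun θ => u (t + θ) - u θ := by
    have h1 := (isH1On_shift hu hz t).add ((isH1On_shift hu hz 0).smul (-1))
    convert h1 using 1 <;> funext θ <;> simp [sub_eq_add_neg]
  refine S.trans_mem_graphAt h0 (integral_rep_shift_snd hu hz t) ?_ ?_ ?_
  · rw [WithLp.sub_fst, IsH1On.rep_fst, IsH1On.rep_fst, zero_add]
  · rw [WithLp.sub_snd]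
    filter_upwards [Lp.coeFn_sub (isH1On_shift hu hz t).rep.snd (isH1On_shift hu hz 0).rep.snd,
      (isH1On_shift hu hz t).rep_snd, (isH1On_shift hu hz 0).rep_snd] with θ e1 e2 e3
    rw [e1, Pi.sub_apply, e2, e3, zero_add]
  · have e := ContinuousLinearMap.intervalIntegral_comp_comm S.functional
      (hYc.intervalIntegrable (μ := volume) 0 t)
    rw [← e]
    have hu1 : IntervalIntegrable (fun s => u (s - 1)) volume 0 t := by
      have := (hu.comp_add_left (-1)).intervalIntegrable 0 t
      refine this.congr fun s _ => ?_
      rw [neg_add_eq_sub]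
    -- The boundary condition required by `trans_mem_graphAt` is the neutral equation integrated
    -- over (0, t).
    have e2 : ∫ s in (0 : ℝ)..t, S.functional (isH1On_shift hu hz s).rep =
        ∫ s in (0 : ℝ)..t, (u s - Matrix.toEuclideanCLM (𝕜 := ℝ) S.A₁ (u (s - 1))) := by
      refine intervalIntegral.integral_congr_ae ?_
      rw [uIoc_of_le ht]
      filter_upwards [(ae_restrict_iff' measurableSet_Ioi).1 heq] with s hs hst
      rw [functional_rep]
      exact eq_sub_of_add_eq' (hs hst.1).symm
    rw [e2, intervalIntegral.integral_sub (hu.intervalIntegrable _ _)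
      ⟨(Matrix.toEuclideanCLM (𝕜 := ℝ) S.A₁).integrable_comp hu1.1,
        (Matrix.toEuclideanCLM (𝕜 := ℝ) S.A₁).integrable_comp hu1.2⟩,
      ContinuousLinearMap.intervalIntegral_comp_comm _ hu1]
    have e3 : ∀ a b, ∫ s in a..b, u s = z b - z a := fun a b => by
      rw [hz a, hz b, add_sub_add_left_eq_sub, intervalIntegral.integral_interval_sub_left
        (hu.intervalIntegrable _ _) (hu.intervalIntegrable _ _)]
    rw [e3, intervalIntegral.integral_comp_sub_right u 1, e3, zero_sub, add_zero]
    rfl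

end System

/-! ### Gluing pieces of length one. -/

section Gluing

variable {n : ℕ}

/-- The function on `(-1, ∞)` that is `(y k).snd (· - k)` on `(k - 1, k]`, extended by zero. -/
noncomputable def glue (y : ℕ → M₂ n) (t : ℝ) : E n := ext0 (y ⌈t⌉₊).snd (t - ⌈t⌉₊)

theorem glue_add (y : ℕ → M₂ n) (k : ℕ) {θ : ℝ} (hθ : θ ∈ Ioc (-1 : ℝ) 0) :
    glue y (k + θ) = (y k).snd θ := by
  have h : ⌈(k : ℝ) + θ⌉₊ = k := by
    -- The case k = 0 is separate because the natural ceiling is 0 on the whole half-line t ≤ 0; for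
    -- t ≤ -1 it is `ext0` that makes `glue` vanish.
    rcases Nat.eq_zero_or_pos k with rfl | hk
    · exact Nat.ceil_eq_zero.2 (by simpa using hθ.2)
    · rw [Nat.ceil_eq_iff hk.ne', Nat.cast_sub hk]
      push_cast
      exact ⟨by linarith [hθ.1], by linarith [hθ.2]⟩
  rw [glue, h, add_sub_cancel_left, ext0_of_mem hθ]

theorem isPastL2_glue (y : ℕ → M₂ n) : IsPastL2 (glue y) := by
  intro T
  refine ⟨fun t => ∑ j ∈ Finset.range (⌈T⌉₊ + 1), ext0 (y j).snd (t - j), ?_, fun t ht => ?_⟩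
  · refine memLp_finsetSum _ fun j _ => ?_
    exact (memLp_ext0 (Lp.memLp _)).comp_measurePreserving (measurePreserving_sub_right volume (j : ℝ))
  · refine Eq.symm (Finset.sum_eq_single (f := fun j : ℕ => ext0 (y j).snd (t - j)) ⌈t⌉₊
      (fun j _ hj => ?_) fun h => ?_)
    · refine ext0_of_notMem fun h => hj ?_
      rcases Nat.eq_zero_or_pos j with rfl | hk
      · exact (Nat.ceil_eq_zero.2 (by simpa using h.2)).symm
      · refine ((Nat.ceil_eq_iff hk.ne').2 ?_).symm
        rw [Nat.cast_sub hk]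
        push_cast
        exact ⟨by linarith [h.1], by linarith [h.2]⟩
    · exact absurd (Finset.mem_range.2 (Nat.lt_succ_of_le (Nat.ceil_mono ht))) h

/-- The primitive of `glue y` with the initial value `(y 0).fst` at `-1`. -/
noncomputable def gluePrim (y : ℕ → M₂ n) (t : ℝ) : E n :=
  (y 0).fst + ∫ s in (-1)..t, glue y s

theorem gluePrim_eq (y : ℕ → M₂ n) (t : ℝ) :
    gluePrim y t = gluePrim y (-1) + ∫ s in (-1)..t, glue y s := by
  simp [gluePrim]

theorem gluePrim_add {y : ℕ → M₂ n} (hy : ∀ k, (y (k + 1)).fst = prim (y k) 0) (k : ℕ) {θ : ℝ}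
    (hθ : θ ∈ Icc (-1 : ℝ) 0) : gluePrim y (k + θ) = prim (y k) θ := by
  have hH := isH1On_shift (isPastL2_glue y) (gluePrim_eq y) k
  refine hH.eq_prim ?_ ?_ hθ
  · induction k with
    | zero => simp [gluePrim]
    | succ k ih =>
      have hH' := isH1On_shift (isPastL2_glue y) (gluePrim_eq y) k
      have h := hH'.eq_prim (ih hH') (by
        filter_upwards [ae_restrict_mem measurableSet_Ioc] with s hs
        exact (glue_add y k hs).symm) (θ := 0) (by norm_num)
      rw [hy, ← h]
      push_cast
      congr 1
      ring
  · filter_upwards [ae_restrict_mem measurableSet_Ioc] with s hs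
    exact (glue_add y k hs).symm

/-- A correlation at a point of `(k, k + 1]` splits into the contributions of the past and the
future of `k`. -/
theorem corr_shift_eq {K : ℝ → E n →L[ℝ] E n} (hK : MemLp K 2 μ) {w f g : ℝ → E n} {k : ℝ}
    (hf : MemLp f 2 μ) (hg : MemLp g 2 μ) (hwf : ∀ θ ∈ Ioc (-1 : ℝ) 0, w (k + θ) = f θ)
    (hwg : ∀ θ ∈ Ioc (-1 : ℝ) 0, w (k + 1 + θ) = g θ) {t : ℝ} (ht : t ∈ Ioc k (k + 1)) :
    corr K (ext0 fun θ => w (t + θ)) 0 = corr K (ext0 g) (t - k - 1) + corr K (ext0 f) (t - k) := by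
  rw [corr, corr, corr, ← integral_add (integrable_corr hK (memLp_ext0 hg) _)
    (integrable_corr hK (memLp_ext0 hf) _)]
  refine setIntegral_congr_fun measurableSet_Ioc fun s hs => ?_
  simp only [zero_add]
  rw [ext0_of_mem hs, ← map_add]
  congr 1
  have ht1 := ht.1
  have ht2 := ht.2
  have hs1 := hs.1
  have hs2 := hs.2
  -- The point t+s = k counts as past, in accordance with the half-open intervals, so exactly one of
  -- the two correlations contributes.
  by_cases h : t + s ≤ k
  · rw [ext0_of_notMem (fun h' => by linarith [h'.1]), zero_add,
      ext0_of_mem ⟨by linarith, by linarith⟩, ← hwf _ ⟨by linarith, by linarith⟩]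
    congr 1
    ring
  · rw [ext0_of_notMem (θ := t - k + s) (fun h' => by linarith [h'.2]), add_zero,
      ext0_of_mem ⟨by linarith, by linarith⟩, ← hwg _ ⟨by linarith, by linarith⟩]
    congr 1
    ring

end Gluing

/-! ### Solving the neutral equation and identifying the relation. -/

namespace System

variable {n : ℕ} (S : System n)

/-- The neutral type equation can be solved one unit of time ahead. -/
theorem exists_step (y : M₂ n) : ∃ y₁ : M₂ n, y₁.fst = prim y 0 ∧
    ∀ᵐ θ ∂μ, y₁.snd (-1 - θ) = app S.A₁ (y.snd (-1 - θ))
      + (corr (kernel S.A₂) (ext0 y₁.snd) (-1 - θ) + corr (kernel S.A₂) (ext0 y.snd) (0 - θ))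
      + (corr (kernel S.A₃) (ext0 (prim y₁)) (-1 - θ)
        + corr (kernel S.A₃) (ext0 (prim y)) (0 - θ)) := by
  have hK2 := memLp_kernel S.memLp₂
  have hK3 := memLp_kernel S.memLp₃
  -- The second component to be attained by `trans`: everything known from the previous piece, minus
  -- A₂(θ)φ(0), which offsets the term A₂(θ)φ(-1) of `trans` since the new piece starts at the value
  -- φ(0).
  have hm : MemLp (fun θ => app S.A₁ (y.snd (-1 - θ)) + corr (kernel S.A₂) (ext0 y.snd) (0 - θ)
      + corr (kernel S.A₃) (ext0 (prim y)) (0 - θ) - kernel S.A₂ θ (prim y 0)) 2 μ :=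
    ((((Matrix.toEuclideanCLM (𝕜 := ℝ) S.A₁).comp_memLp'
      (memLp_comp_refl (Lp.memLp y.snd))).add (memLp_corr_sub hK2 (Lp.memLp y.snd) 0)).add
      (memLp_corr_sub hK3 (memLp_prim y) 0)).sub (memLp_apply_const hK2 (prim y 0))
  obtain ⟨y₁, hy₁⟩ := S.trans_bijective.2 (WithLp.toLp 2 (prim y 0, hm.toLp))
  have h1 : y₁.fst = prim y 0 := (congrArg WithLp.fst hy₁ : _)
  have h2 : S.transSnd y₁ = hm.toLp := (congrArg WithLp.snd hy₁ : _)
  refine ⟨y₁, h1, ?_⟩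
  have h3 := S.coeFn_transSnd y₁
  rw [h2, h1] at h3
  filter_upwards [h3, hm.coeFn_toLp] with θ e1 e2
  rw [e2, kernel_apply] at e1
  have e3 := sub_eq_iff_eq_add.1 (sub_eq_iff_eq_add.1 (sub_eq_iff_eq_add.1 e1.symm))
  rw [e3]
  abel

theorem glue_satisfies {y : ℕ → M₂ n} (hy : ∀ k, (y (k + 1)).fst = prim (y k) 0)
    (hstep : ∀ k, ∀ᵐ θ ∂μ, (y (k + 1)).snd (-1 - θ) = app S.A₁ ((y k).snd (-1 - θ))
      + (corr (kernel S.A₂) (ext0 (y (k + 1)).snd) (-1 - θ)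
        + corr (kernel S.A₂) (ext0 (y k).snd) (0 - θ))
      + (corr (kernel S.A₃) (ext0 (prim (y (k + 1)))) (-1 - θ)
        + corr (kernel S.A₃) (ext0 (prim (y k))) (0 - θ))) :
    ∀ᵐ t ∂(volume.restrict (Ioi (0 : ℝ))), glue y t = app S.A₁ (glue y (t - 1)) +
      S.L (fun θ => gluePrim y (t + θ)) (fun θ => glue y (t + θ)) := by
  have hall : ∀ k : ℕ, ∀ᵐ t : ℝ, t ∈ Ioc (k : ℝ) (k + 1) →
      glue y t = app S.A₁ (glue y (t - 1)) +
        S.L (fun θ => gluePrim y (t + θ)) (fun θ => glue y (t + θ)) := by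
    intro k
    have h1 := (ae_restrict_iff' measurableSet_Ioc).1 (hstep k)
    have h2 := (Measure.measurePreserving_sub_left volume (k : ℝ)).quasiMeasurePreserving.ae h1
    -- The substitution θ = k - t maps (-1, 0] to [k, k+1), so the endpoint k+1 has to be discarded.
    have h3 : ∀ᵐ t : ℝ, t ≠ k + 1 := by simp [ae_iff, measure_singleton]
    filter_upwards [h2, h3] with t h4 h5 ht
    have ht1 := ht.1
    have ht2 : t < k + 1 := lt_of_le_of_ne ht.2 h5
    have e := h4 ⟨by linarith, by linarith⟩
    have e1 : (y (k + 1)).snd (-1 - (k - t)) = glue y t := by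
      rw [← glue_add y (k + 1) ⟨by linarith, by linarith⟩]
      push_cast
      congr 1
      ring
    have e2 : (y k).snd (-1 - (k - t)) = glue y (t - 1) := by
      rw [← glue_add y k ⟨by linarith, by linarith⟩]
      congr 1
      ring
    have hglue : ∀ θ ∈ Ioc (-1 : ℝ) 0, glue y (k + 1 + θ) = (y (k + 1)).snd θ := fun θ hθ => by
      have := glue_add y (k + 1) hθ
      push_cast at this
      exact this
    have hgluePrim : ∀ θ ∈ Ioc (-1 : ℝ) 0, gluePrim y (k + 1 + θ) = prim (y (k + 1)) θ :=
      fun θ hθ => by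
        have := gluePrim_add hy (k + 1) (Ioc_subset_Icc_self hθ)
        push_cast at this
        exact this
    rw [S.L_eq_corr _ _ (isH1On_shift (isPastL2_glue y) (gluePrim_eq y) t),
      corr_shift_eq (memLp_kernel S.memLp₂) (Lp.memLp (y k).snd) (Lp.memLp (y (k + 1)).snd)
        (fun θ hθ => glue_add y k hθ) hglue ht,
      corr_shift_eq (memLp_kernel S.memLp₃) (memLp_prim (y k)) (memLp_prim (y (k + 1)))
        (fun θ hθ => gluePrim_add hy k (Ioc_subset_Icc_self hθ)) hgluePrim ht]
    rw [e1, e2, show (-1 : ℝ) - (k - t) = t - k - 1 by ring,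
      show (0 : ℝ) - (k - t) = t - k by ring] at e
    rw [e, add_assoc]
  rw [ae_restrict_iff' measurableSet_Ioi]
  filter_upwards [ae_all_iff.2 hall] with t ht h0
  have h0' : 0 < t := h0
  have hc : 0 < ⌈t⌉₊ := Nat.ceil_pos.2 h0'
  refine ht (⌈t⌉₊ - 1) ⟨?_, ?_⟩
  · exact ((Nat.ceil_eq_iff hc.ne').1 rfl).1
  · rw [Nat.cast_sub hc]
    push_cast
    linarith [Nat.le_ceil t]

/-- Every function of `H¹` is the initial part of a solution of the neutral type equation, and the
transformation maps its state to the related initial data. -/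
theorem initialRelation_trans (y₀ : M₂ n) :
    S.InitialRelation (S.stateL y₀) (S.trans y₀) := by
  choose step hstep1 hstep2 using S.exists_step
  set y : ℕ → M₂ n := fun k => step^[k] y₀
  have hsucc : ∀ k, y (k + 1) = step (y k) := fun k => Function.iterate_succ_apply' step k y₀
  have hy : ∀ k, (y (k + 1)).fst = prim (y k) 0 := fun k => by rw [hsucc, hstep1]
  have heq := S.glue_satisfies hy fun k => by
    rw [hsucc]
    exact hstep2 (y k)
  have hu := isPastL2_glue y
  have hz := gluePrim_eq y
  have hH0 : ∀ θ ∈ Icc (-1 : ℝ) 0, gluePrim y θ = prim y₀ θ := fun θ hθ => by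
    have := gluePrim_add hy 0 hθ
    rwa [Nat.cast_zero, zero_add] at this
  have hrep : (isH1On_shift hu hz 0).rep = y₀ := by
    refine WithLp.ofLp_injective 2 (Prod.ext ?_ (Lp.ext ?_))
    · change gluePrim y (0 + -1) = y₀.fst
      rw [zero_add, hH0 _ (by norm_num), prim_neg_one]
    · refine (isH1On_shift hu hz 0).rep_snd.trans ?_
      filter_upwards [ae_restrict_mem measurableSet_Ioc] with θ hθ
      have := glue_add y 0 hθ
      rwa [Nat.cast_zero] at this
  have hmild := S.isMildSolution_trans_rep hu hz heq
  rw [hrep] at hmild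
  refine ⟨_, gluePrim y, glue y, hmild, fun t _ => ?_, ⟨fun T _ => ⟨hu.memLp_restrict _ _,
    fun θ _ => hz θ⟩, heq⟩, ⟨hu.memLp_restrict _ _, fun θ _ => hz θ⟩, ?_, ?_⟩
  · rw [trans_fst, IsH1On.rep_fst, add_neg_cancel_right]
  · refine (coeFn_primL y₀).trans ?_
    filter_upwards [ae_restrict_mem measurableSet_Ioc] with θ hθ
    exact (hH0 θ (Ioc_subset_Icc_self hθ)).symm
  · rw [stateL_fst, hH0 _ (by norm_num), hH0 _ (by norm_num)]

/-- The related initial data are given by the transformation. -/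
theorem InitialRelation.eq_trans {S : System n} {y₀ x₀ : M₂ n}
    (h : S.InitialRelation (S.stateL y₀) x₀) : x₀ = S.trans y₀ := by
  obtain ⟨x, z, z', hx, hz, -, hst⟩ := h
  obtain ⟨x₂, z₂, z₂', hx₂, hz₂, -, hst₂⟩ := S.initialRelation_trans y₀
  have hrep : ∀ {w w' : ℝ → E n} (hw : S.IsState (S.stateL y₀) w w'), ∀ θ ∈ Icc (-1 : ℝ) 0,
      w θ = prim y₀ θ := fun hw θ hθ => by
    rw [← hw.1.prim_rep hθ, S.stateL_injective hw.stateL_rep]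
  -- Both functions z coincide on [-1, 0] with the φ encoded by `y₀`, so the first components of
  -- both mild solutions coincide on [0, 1].
  refine initial_eq_of_fst_eq hx hx₂ fun t ht => ?_
  have h1 := hz (t - 1) (by linarith [ht.1])
  have h2 := hz₂ (t - 1) (by linarith [ht.1])
  rw [sub_add_cancel] at h1 h2
  rw [← h1, ← h2, hrep hst _ ⟨by linarith [ht.1], by linarith [ht.2]⟩,
    hrep hst₂ _ ⟨by linarith [ht.1], by linarith [ht.2]⟩]

end System

end Neutral

/-- F passes from a state to its encoding in `M₂` and then applies `trans`. Both factors are bounded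
with bounded inverse, the first by the two graph norm estimates. -/
theorem mainTheorem3 (n : ℕ) (S : Neutral.System n) :
    ∃ F : S.opA.domain ≃ₗ[ℝ] Neutral.M₂ n,
      (∀ (ξ₀ : S.opA.domain) (x₀ : Neutral.M₂ n),
        S.InitialRelation (ξ₀ : Neutral.M₂ n) x₀ ↔ x₀ = F ξ₀) ∧
      (∃ C : ℝ, ∀ ξ₀ : S.opA.domain, ‖F ξ₀‖ ≤ C * Neutral.graphNorm S.opA ξ₀) ∧
      (∃ C : ℝ, ∀ x₀ : Neutral.M₂ n, Neutral.graphNorm S.opA (F.symm x₀) ≤ C * ‖x₀‖) := by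
  refine ⟨S.stateEquiv.symm.trans S.transEquiv.toLinearEquiv, fun ξ₀ x₀ => ?_, ?_, ?_⟩
  · obtain ⟨y, rfl⟩ := S.stateEquiv.surjective ξ₀
    have hF : (S.stateEquiv.symm.trans S.transEquiv.toLinearEquiv) (S.stateEquiv y) = S.trans y :=
      congrArg S.trans (S.stateEquiv.symm_apply_apply y)
    rw [hF, S.coe_stateEquiv]
    exact ⟨fun h => h.eq_trans, fun h => h ▸ S.initialRelation_trans y⟩
  · obtain ⟨C, hC, h⟩ := S.exists_le_graphNorm
    refine ⟨‖S.trans‖ * C, fun ξ₀ => ?_⟩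
    have h1 := h (S.stateEquiv.symm ξ₀)
    rw [LinearEquiv.apply_symm_apply] at h1
    calc ‖S.trans (S.stateEquiv.symm ξ₀)‖ ≤ ‖S.trans‖ * ‖S.stateEquiv.symm ξ₀‖ :=
          S.trans.le_opNorm _
      _ ≤ ‖S.trans‖ * (C * Neutral.graphNorm S.opA ξ₀) := by gcongr
      _ = _ := (mul_assoc _ _ _).symm
  · obtain ⟨C, hC, h⟩ := S.exists_graphNorm_le
    refine ⟨C * ‖(S.transEquiv.symm : Neutral.M₂ n →L[ℝ] Neutral.M₂ n)‖, fun x₀ => ?_⟩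
    calc Neutral.graphNorm S.opA (S.stateEquiv (S.transEquiv.symm x₀))
        ≤ C * ‖S.transEquiv.symm x₀‖ := h _
      _ ≤ C * (‖(S.transEquiv.symm : Neutral.M₂ n →L[ℝ] Neutral.M₂ n)‖ * ‖x₀‖) := by
          gcongr
          exact (S.transEquiv.symm : Neutral.M₂ n →L[ℝ] Neutral.M₂ n).le_opNorm x₀
      _ = _ := (mul_assoc _ _ _).symm
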